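/- A continuum is a non-empty compact connected metric space. A dendroid is an arcwise connected continuum all of whose subcontinua $A$ are unicoherent (if $A=B\cup C$ with subcontinua $B,C$, then $B\cap C$ is connected). An endpoint of a dendroid is a point that is an endpoint of every arc containing it, and a ramification point is the top (the centre) of a simple triod contained in the dendroid. A fan is a dendroid $F$ with exactly one ramification point $t$, its top; $E(F)$ is its set of endpoints. For $x,y\in F$ let $[x,y]$ be the unique arc with endpoints $x,y$ (and $[x,x]=\{x\}$); the blades of $F$ are the arcs $[t,e]$ with $e\in E(F)$. The fan $F$ is smooth if $x_n\to x$ implies $[t,x_n]\to[t,x]$ in the Hausdorff metric. It is endpoint-homogeneous if for all $e,e'\in E(F)$ there is a homeomorphism $h:F\to F$ with $h(e)=e'$. For $X\subseteq[0,1]$, it is an $X$-EPG fan if for every blade $B$ there is a homeomorphism $\phi:[0,1]\to B$ with $\phi(0)=t$ and $\phi[X]=B\cap\overline{E(F)\setminus B}$. **Theorem.** Let $X\subseteq[0,1]$ be closed with $0,1\in X$ and with $1$ an isolated point of $X$. Then there is an endpoint-homogeneous, $X$-EPG smooth fan. More precisely, there is an endpoint-homogeneous, $(X\setminus\{1\})$-EPG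 smooth fan $F_Y$, with top $t_0$, such that the quotient space obtained from $F_Y\times K$, where $K$ is the Cantor set, by collapsing $\{t_0\}\times K$ to a point is metrizable and is an endpoint-homogeneous, $X$-EPG smooth fan. -/

import Mathlib

open Set Filter Topology

namespace Fans

/-- An arc: a subset homeomorphic to the unit interval. -/
def IsArc {α : Type*} [TopologicalSpace α] (A : Set α) : Prop :=
  Nonempty (unitInterval ≃ₜ A)

/-- The endpoints of an arc `A`: the points whose removal leaves `A` connected. -/
def IsArcEndpoint {α : Type*} [TopologicalSpace α] (A : Set α) (a : α) : Prop :=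
  a ∈ A ∧ IsConnected (A \ {a})

/-- `A` is an arc whose two endpoints are the distinct points `x` and `y`. -/
def IsArcJoining {α : Type*} [TopologicalSpace α] (A : Set α) (x y : α) : Prop :=
  IsArc A ∧ x ≠ y ∧ IsArcEndpoint A x ∧ IsArcEndpoint A y

/-- A subcontinuum, as a subset of the ambient space: compact, connected and non-empty. -/
def IsSubcontinuum {α : Type*} [TopologicalSpace α] (A : Set α) : Prop :=
  IsCompact A ∧ IsConnected A

/-- A set is unicoherent if, whenever it is the union of two subcontinua, these have connected
intersection. -/
def IsUnicoherent {α : Type*} [TopologicalSpace α] (A : Set α) : Prop :=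
  ∀ B C : Set α, IsSubcontinuum B → IsSubcontinuum C → A = B ∪ C → IsPreconnected (B ∩ C)

/-- A dendroid: an arcwise connected, hereditarily unicoherent continuum, a continuum being a
non-empty compact connected metric space. -/
structure IsDendroid (α : Type*) [MetricSpace α] : Prop where
  continuum : IsSubcontinuum (univ : Set α)
  arcwise_connected : ∀ x y : α, x ≠ y → ∃ A : Set α, IsArcJoining A x y
  hereditarily_unicoherent : ∀ A : Set α, IsSubcontinuum A → IsUnicoherent A

/-- The set `E(α)` of endpoints of the space: the points that are an endpoint of every arc that
contains them. -/
def endpoints (α : Type*) [TopologicalSpace α] : Set α :=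
  {x | ∀ A : Set α, IsArc A → x ∈ A → IsArcEndpoint A x}

/-- The model of a simple triod. Its top, the unique point whose removal leaves three connected
components, is the origin. -/
def triod : Set (ℝ × ℝ) := Icc (-1) 1 ×ˢ {0} ∪ {0} ×ˢ Icc 0 1

theorem origin_mem_triod : ((0, 0) : ℝ × ℝ) ∈ triod := by
  simp [triod]

/-- The top of the model triod. -/
def triodTop : triod := ⟨(0, 0), origin_mem_triod⟩

/-- The set `R(α)` of ramification points: the tops of the simple triods in the space. -/
def ramificationPoints (α : Type*) [TopologicalSpace α] : Set α :=
  {x | ∃ (T : Set α) (h : triod ≃ₜ T), (h triodTop : α) = x}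

/-- The space is a fan with top `t`: a dendroid whose only ramification point is `t`. -/
def IsFanWithTop (α : Type*) [MetricSpace α] (t : α) : Prop :=
  IsDendroid α ∧ ramificationPoints α = {t}

open Classical in
/-- The set `[x, y]`: it is `{x}` if `x = y`, and otherwise the arc with endpoints `x` and `y`.
In a dendroid there is exactly one such arc, so that it is the union of all of them. -/
noncomputable def arcBetween {α : Type*} [TopologicalSpace α] (x y : α) : Set α :=
  if x = y then {x} else ⋃₀ {A | IsArcJoining A x y}

/-- The blades of a fan with top `t`: the arcs from `t` to the endpoints of the fan. -/
def blades {α : Type*} [TopologicalSpace α] (t : α) : Set (Set α) :=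
  {B | ∃ e ∈ endpoints α, B = arcBetween t e}

/-- The fan with top `t` is smooth: if `x n` converges to `a`, then `[t, x n]` converges to
`[t, a]` in the Hausdorff metric. -/
def IsSmoothAt {α : Type*} [MetricSpace α] (t : α) : Prop :=
  ∀ (x : ℕ → α) (a : α), Tendsto x atTop (𝓝 a) →
    Tendsto (fun n => Metric.hausdorffDist (arcBetween t (x n)) (arcBetween t a)) atTop (𝓝 0)

/-- Any two endpoints are exchanged by some self-homeomorphism. -/
def EndpointHomogeneous (α : Type*) [TopologicalSpace α] : Prop :=
  ∀ e ∈ endpoints α, ∀ e' ∈ endpoints α, ∃ h : α ≃ₜ α, h e = e'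

/-- The fan with top `t` is an `X`-endpoint generated (`X`-EPG) fan. -/
def IsEPG {α : Type*} [TopologicalSpace α] (t : α) (X : Set unitInterval) : Prop :=
  ∀ B ∈ blades t, ∃ φ : unitInterval ≃ₜ B,
    (φ 0 : α) = t ∧ (fun s => (φ s : α)) '' X = B ∩ closure (endpoints α \ B)

/-- The space is an endpoint-homogeneous, `X`-EPG smooth fan with top `t`. -/
structure IsEndpointHomogeneousSmoothEPGFan (α : Type*) [MetricSpace α] (t : α)
    (X : Set unitInterval) : Prop where
  fan : IsFanWithTop α t
  smooth : IsSmoothAt t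
  endpointHomogeneous : EndpointHomogeneous α
  epg : IsEPG t X

/-- The equivalence relation on `α × K`, with `K` the Cantor set, that identifies all points of
`{t} × K` with one another, and no other points. -/
def collapseSetoid {α : Type*} (t : α) : Setoid (α × cantorSet) where
  r p q := p = q ∨ (p.1 = t ∧ q.1 = t)
  iseqv :=
    { refl := fun _ => Or.inl rfl
      symm := by
        rintro p q (h | ⟨h₁, h₂⟩)
        · exact Or.inl h.symm
        · exact Or.inr ⟨h₂, h₁⟩
      trans := by
        rintro p q r (rfl | ⟨h₁, h₂⟩) (rfl | ⟨h₃, h₄⟩)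
        · exact Or.inl rfl
        · exact Or.inr ⟨h₃, h₄⟩
        · exact Or.inr ⟨h₁, h₂⟩
        · exact Or.inr ⟨h₁, h₄⟩ }

/-- The quotient space of `α × K` obtained by collapsing `{t} × K` to a point, with the quotient
topology. -/
abbrev CollapsedProduct {α : Type*} (t : α) : Type _ := Quotient (collapseSetoid t)

end Fans

/-! Write `Y = X \ {1}`. Both fans are carved out of the cone over `2^ℕ × P`, with `P` a point for
`F_Y` and the Cantor set for the other, by prescribing the length of each ray. Since 1 is isolated
in `X`, the set `Y` is closed and lies below some `b < 1`, so there are lengths `0 < y n ≤ b` whose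
cluster points are exactly the points of `Y`. For each `n` an increasing homeomorphism `bend n`
fixes 0, sends 1 to `y n` and squeezes `[0, b]` into `[0, 1/(n+1)]`. The ray over `(x, p)` gets as
length the infimum over `N` of the values at 1 of the composites `param N x` of the bends with index
`n < N` and `x n = true`, larger indices being applied first. Each bend contracts `[0, 1]` towards 0
by the factor `b` at least, so the length is positive exactly when `x` has finite support.

Blades seen from the blade over `x`, in its own parameter: a nearby blade over `z` agrees with `x`
on a long initial stretch. If `z` adds one index `n`, its tip has relative height `y n`; if it adds
more, the least being `n`, its tip lies below `bend n b ≤ 1/(n+1)`, hence near `0 ∈ Y`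
(`param_symm_near`). So such tips accumulate exactly on `Y`. If `P` is the Cantor set, the blades
over `(x, p')` with `p' → p` add the limit 1.

Endpoint-homogeneity comes from translating `2^ℕ` by a finitely supported sequence: only finitely
many outermost factors of the composites change, and reparametrizing each ray compensates for that
(`translate`).

The fan axioms and smoothness need only the rays: off the top there is a continuous direction in a
totally disconnected space, so a connected set missing the top lies in one ray. `RadialModel`
isolates this argument. -/

open Set Filter Topology

namespace Fans

/-! ### Arcs and their endpoints -/

section Arcs

variable {α : Type*} [TopologicalSpace α] [T2Space α]

/-- An arc is the range of an injective path. -/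
theorem IsArc.exists_path {α : Type*} [TopologicalSpace α] {A : Set α} (hA : IsArc A) :
    ∃ γ : unitInterval → α, IsEmbedding γ ∧ range γ = A := by
  obtain ⟨ψ⟩ := hA
  refine ⟨fun s => (ψ s : α), IsEmbedding.subtypeVal.comp ψ.isEmbedding, ?_⟩
  have : range ((Subtype.val : A → α) ∘ ψ) = A := by
    rw [range_comp, ψ.surjective.range_eq, image_univ, Subtype.range_coe]
  exact this

theorem isArc_range {γ : unitInterval → α} (hc : Continuous γ) (hi : Function.Injective γ) :
    IsArc (range γ) :=
  ⟨(hc.isClosedEmbedding hi).isEmbedding.toHomeomorph⟩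

theorem isPreconnected_compl_singleton_unitInterval_iff {s : unitInterval} :
    IsPreconnected ({s}ᶜ : Set unitInterval) ↔ s = 0 ∨ s = 1 := by
  constructor
  · intro h
    by_contra! hs
    have h0 : (0 : unitInterval) ∈ ({s}ᶜ : Set unitInterval) := fun h => hs.1 h.symm
    have h1 : (1 : unitInterval) ∈ ({s}ᶜ : Set unitInterval) := fun h => hs.2 h.symm
    exact h.Icc_subset h0 h1 ⟨unitInterval.nonneg', unitInterval.le_one'⟩ rfl
  · rintro (rfl | rfl)
    · rw [← IsInducing.subtypeVal.isPreconnected_image]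
      convert (isPreconnected_Ioc (a := (0 : ℝ)) (b := 1)) using 1
      ext r
      constructor
      · rintro ⟨u, hu, rfl⟩
        exact ⟨unitInterval.pos_iff_ne_zero.2 hu, u.2.2⟩
      · intro hr
        exact ⟨⟨r, hr.1.le, hr.2⟩, fun h => hr.1.ne' (congrArg Subtype.val h), rfl⟩
    · rw [← IsInducing.subtypeVal.isPreconnected_image]
      convert (isPreconnected_Ico (a := (0 : ℝ)) (b := 1)) using 1
      ext r
      constructor
      · rintro ⟨u, hu, rfl⟩
        exact ⟨u.2.1, unitInterval.lt_one_iff_ne_one.2 hu⟩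
      · intro hr
        exact ⟨⟨r, hr.1, hr.2.le⟩, fun h => hr.2.ne (congrArg Subtype.val h), rfl⟩

theorem isArcEndpoint_range_iff {α : Type*} [TopologicalSpace α] {γ : unitInterval → α}
    (hγ : IsEmbedding γ) {s : unitInterval} :
    IsArcEndpoint (range γ) (γ s) ↔ s = 0 ∨ s = 1 := by
  have himg : range γ \ {γ s} = γ '' {s}ᶜ := by
    rw [← image_univ, ← image_singleton, ← image_sdiff hγ.injective, compl_eq_univ_sdiff]
  have hne : ({s}ᶜ : Set unitInterval).Nonempty := by
    by_cases h : s = 0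
    · exact ⟨1, fun h' => by simp [h] at h'⟩
    · exact ⟨0, fun h' => h h'.symm⟩
  rw [← isPreconnected_compl_singleton_unitInterval_iff, IsArcEndpoint, himg, IsConnected,
    hγ.isInducing.isPreconnected_image]
  exact ⟨fun h => h.2.2, fun h => ⟨mem_range_self s, hne.image _, h⟩⟩

theorem isArcJoining_range {γ : unitInterval → α} (hc : Continuous γ)
    (hi : Function.Injective γ) : IsArcJoining (range γ) (γ 0) (γ 1) :=
  have hγ := (hc.isClosedEmbedding hi).isEmbedding
  ⟨isArc_range hc hi, fun h => zero_ne_one (hi h), (isArcEndpoint_range_iff hγ).2 (Or.inl rfl),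
    (isArcEndpoint_range_iff hγ).2 (Or.inr rfl)⟩

theorem IsArcJoining.symm {α : Type*} [TopologicalSpace α] {A : Set α} {x y : α}
    (h : IsArcJoining A x y) : IsArcJoining A y x :=
  ⟨h.1, h.2.1.symm, h.2.2.2, h.2.2.1⟩

/-- A connected subset of an arc containing both endpoints is the whole arc. -/
theorem IsArcJoining.subset_of_isPreconnected {α : Type*} [TopologicalSpace α] {A S : Set α}
    {x y : α} (hA : IsArcJoining A x y) (hSA : S ⊆ A) (hS : IsPreconnected S)
    (hx : x ∈ S) (hy : y ∈ S) : A ⊆ S := by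
  obtain ⟨hA1, hne, hxA, hyA⟩ := hA
  obtain ⟨γ, hγ, rfl⟩ := hA1.exists_path
  obtain ⟨u, rfl⟩ := hxA.1
  obtain ⟨v, rfl⟩ := hyA.1
  rw [isArcEndpoint_range_iff hγ] at hxA hyA
  have hpre : IsPreconnected (γ ⁻¹' S) := by
    rw [← hγ.isInducing.isPreconnected_image, image_preimage_eq_of_subset hSA]
    exact hS
  have h01 : (0 : unitInterval) ∈ γ ⁻¹' S ∧ (1 : unitInterval) ∈ γ ⁻¹' S := by
    rcases hxA with rfl | rfl <;> rcases hyA with rfl | rfl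
    · exact absurd rfl hne
    · exact ⟨hx, hy⟩
    · exact ⟨hy, hx⟩
    · exact absurd rfl hne
  rintro _ ⟨w, rfl⟩
  exact hpre.Icc_subset h01.1 h01.2 ⟨unitInterval.nonneg', unitInterval.le_one'⟩

end Arcs

/-! ### Spaces swept out by rays from a point -/

/-- A continuous injective function on an interval maps it onto a neighbourhood of the value at
any interior point. -/
theorem image_Icc_mem_nhds_of_injOn {g : ℝ → ℝ} {a b s : ℝ} (has : a < s) (hsb : s < b)
    (hc : ContinuousOn g (Icc a b)) (hi : InjOn g (Icc a b)) : g '' Icc a b ∈ 𝓝 (g s) := by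
  have hab : a ≤ b := (has.trans hsb).le
  have ha : a ∈ Icc a b := ⟨le_rfl, hab⟩
  have hb : b ∈ Icc a b := ⟨hab, le_rfl⟩
  have hs : s ∈ Icc a b := ⟨has.le, hsb.le⟩
  rcases hc.strictMonoOn_of_injOn_Icc' hab hi with h | h
  · exact mem_of_superset (Icc_mem_nhds (h ha hs has) (h hs hb hsb)) (intermediate_value_Icc hab hc)
  · exact mem_of_superset (Icc_mem_nhds (h hs hb hsb) (h ha hs has))
      (intermediate_value_Icc' hab hc)

/-- A space swept out by rays from `t`: every point other than `t` has a direction in `D` and a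
positive height which together determine it, and can be moved continuously down to `t`. -/
structure RadialModel (F D : Type*) [TopologicalSpace F] [TopologicalSpace D] (t : F) where
  height : F → ℝ
  dir : F → D
  scale : unitInterval → F → F
  continuous_height : Continuous height
  continuousOn_dir : ContinuousOn dir {t}ᶜ
  continuous_scale : Continuous (fun p : unitInterval × F => scale p.1 p.2)
  height_nonneg : ∀ x, 0 ≤ height x
  height_eq_zero : ∀ x, height x = 0 ↔ x = t
  height_scale : ∀ c x, height (scale c x) = c * height x
  dir_scale : ∀ c x, c ≠ 0 → x ≠ t → dir (scale c x) = dir x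
  ext_of_ne : ∀ x y, x ≠ t → y ≠ t → dir x = dir y → height x = height y → x = y

namespace RadialModel

section Basic

variable {F D : Type*} [TopologicalSpace F] [TopologicalSpace D] {t : F} (M : RadialModel F D t)

theorem height_pos {x : F} (hx : x ≠ t) : 0 < M.height x :=
  lt_of_le_of_ne (M.height_nonneg x) fun h => hx ((M.height_eq_zero x).1 h.symm)

@[simp] theorem height_top : M.height t = 0 := (M.height_eq_zero t).2 rfl

@[simp] theorem scale_zero (x : F) : M.scale 0 x = t := by
  rw [← M.height_eq_zero, M.height_scale]; simp

@[simp] theorem scale_top (c : unitInterval) : M.scale c t = t := by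
  rw [← M.height_eq_zero, M.height_scale]; simp

theorem scale_ne_top {c : unitInterval} {x : F} (hc : c ≠ 0) (hx : x ≠ t) : M.scale c x ≠ t := by
  rw [Ne, ← M.height_eq_zero, M.height_scale]
  have : (c : ℝ) ≠ 0 := fun h => hc (Subtype.ext h)
  exact mul_ne_zero this (M.height_pos hx).ne'

@[simp] theorem scale_one (x : F) : M.scale 1 x = x := by
  by_cases hx : x = t
  · rw [hx, scale_top]
  · exact M.ext_of_ne _ _ (M.scale_ne_top one_ne_zero hx) hx (M.dir_scale _ _ one_ne_zero hx)
      (by rw [M.height_scale]; simp)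

theorem continuous_scale_left (x : F) : Continuous fun c => M.scale c x :=
  M.continuous_scale.comp (by fun_prop : Continuous fun c => (c, x))

theorem scale_injective {x : F} (hx : x ≠ t) : Function.Injective fun c => M.scale c x := by
  intro c d h
  have h2 := congrArg M.height h
  simp only [M.height_scale] at h2
  exact Subtype.ext (mul_right_cancel₀ (M.height_pos hx).ne' h2)

theorem exists_scale_eq {x y : F} (hx : x ≠ t) (hy : y ≠ t) (hd : M.dir y = M.dir x)
    (hh : M.height y ≤ M.height x) : ∃ c : unitInterval, c ≠ 0 ∧ M.scale c x = y := by
  have hx0 := M.height_pos hx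
  have hy0 := M.height_pos hy
  let c : unitInterval := ⟨M.height y / M.height x, by positivity, (div_le_one hx0).2 hh⟩
  have hc : c ≠ 0 := fun h => (div_pos hy0 hx0).ne' (congrArg Subtype.val h)
  refine ⟨c, hc, M.ext_of_ne _ _ (M.scale_ne_top hc hx) hy ?_ ?_⟩
  · rw [M.dir_scale _ _ hc hx, hd]
  · rw [M.height_scale]
    exact div_mul_cancel₀ _ hx0.ne'

/-- The segment from `t` to `x`. -/
def seg (x : F) : Set F := range fun c => M.scale c x

theorem self_mem_seg (x : F) : x ∈ M.seg x := ⟨1, M.scale_one x⟩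

theorem top_mem_seg (x : F) : t ∈ M.seg x := ⟨0, M.scale_zero x⟩

theorem seg_top : M.seg t = {t} := by
  simp [seg]

theorem mem_seg_iff {x y : F} (hx : x ≠ t) (hy : y ≠ t) :
    y ∈ M.seg x ↔ M.dir y = M.dir x ∧ M.height y ≤ M.height x := by
  constructor
  · rintro ⟨c, rfl⟩
    have hc : c ≠ 0 := by rintro rfl; simp at hy
    refine ⟨M.dir_scale _ _ hc hx, ?_⟩
    simp only [M.height_scale]
    exact mul_le_of_le_one_left (M.height_nonneg x) c.2.2
  · rintro ⟨hd, hh⟩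
    obtain ⟨c, -, rfl⟩ := M.exists_scale_eq hx hy hd hh
    exact ⟨c, rfl⟩

theorem isPreconnected_seg (x : F) : IsPreconnected (M.seg x) :=
  isPreconnected_range (M.continuous_scale_left x)

theorem isArcJoining_seg [T2Space F] {x : F} (hx : x ≠ t) : IsArcJoining (M.seg x) t x := by
  have := isArcJoining_range (M.continuous_scale_left x) (M.scale_injective hx)
  simp only [scale_zero, scale_one] at this
  exact this

include M in
theorem isConnected_univ : IsConnected (univ : Set F) :=
  ⟨⟨t, trivial⟩, isPreconnected_of_forall t fun y _ =>
    ⟨M.seg y, subset_univ _, M.top_mem_seg y, M.self_mem_seg y, M.isPreconnected_seg y⟩⟩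

/-- Off `t` the direction is continuous with values in a totally disconnected space. Hence rays can
be changed only by passing through `t`, which drives all the arguments below. -/
theorem dir_eq_of_isPreconnected [TotallyDisconnectedSpace D] {S : Set F} (hS : IsPreconnected S)
    (ht : t ∉ S) {x y : F} (hx : x ∈ S) (hy : y ∈ S) : M.dir x = M.dir y := by
  have h := hS.image M.dir (M.continuousOn_dir.mono fun z hz h => ht (h ▸ hz))
  exact h.subsingleton (mem_image_of_mem _ hx) (mem_image_of_mem _ hy)

/-- Interior points of a curve missing `t`: the curve covers nearby points of the ray. -/
theorem eventually_exists_height_eq [TotallyDisconnectedSpace D] {c : ℝ → F} {a b s : ℝ}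
    (has : a < s) (hsb : s < b) (hc : ContinuousOn c (Icc a b)) (hi : InjOn c (Icc a b))
    (ht : ∀ u ∈ Icc a b, c u ≠ t) :
    ∀ᶠ v in 𝓝 (M.height (c s)),
      ∃ u ∈ Icc a b, M.dir (c u) = M.dir (c s) ∧ M.height (c u) = v := by
  have hs : s ∈ Icc a b := ⟨has.le, hsb.le⟩
  have hdir : ∀ u ∈ Icc a b, ∀ v ∈ Icc a b, M.dir (c u) = M.dir (c v) := fun u hu v hv =>
    M.dir_eq_of_isPreconnected (isPreconnected_Icc.image c hc)
      (by rintro ⟨w, hw, h⟩; exact ht w hw h) (mem_image_of_mem c hu) (mem_image_of_mem c hv)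
  have := image_Icc_mem_nhds_of_injOn (g := fun u => M.height (c u)) has hsb
    (M.continuous_height.comp_continuousOn hc) fun u hu v hv h =>
      hi hu hv (M.ext_of_ne _ _ (ht u hu) (ht v hv) (hdir u hu v hv) h)
  filter_upwards [this] with v hv
  obtain ⟨u, hu, rfl⟩ := hv
  exact ⟨u, hu, hdir u hu s hs, rfl⟩

end Basic

/-! ### Dendroid, fan and smoothness properties of radial spaces -/

section Dendroid

variable {F D : Type*} [MetricSpace F] [TopologicalSpace D] {t : F} (M : RadialModel F D t)

-- On a common ray, a piece of that ray joins the points; otherwise the arc runs down to `t` and up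
-- the other ray.
include M in
theorem exists_isArcJoining {x y : F} (hxy : x ≠ y) : ∃ A, IsArcJoining A x y := by
  have key : ∀ (x : F) (c : unitInterval), x ≠ t → c ≠ 1 →
      ∃ A, IsArcJoining A (M.scale c x) x := by
    intro x c hx hc
    have hc1 : (c : ℝ) < 1 := unitInterval.lt_one_iff_ne_one.2 hc
    let e : unitInterval → unitInterval := fun s =>
      ⟨c + (1 - c) * s, by have := c.2.1; have := s.2.1; have := c.2.2; nlinarith,
        by have := c.2.1; have := s.2.2; nlinarith⟩
    have he : Continuous e := by
      apply Continuous.subtype_mk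
      fun_prop
    have hei : Function.Injective e := by
      intro u v h
      have h2 : (c : ℝ) + (1 - c) * u = c + (1 - c) * v := congrArg Subtype.val h
      exact Subtype.ext (mul_left_cancel₀ (sub_pos.2 hc1).ne' (add_left_cancel h2))
    have h := isArcJoining_range ((M.continuous_scale_left x).comp he)
      ((M.scale_injective hx).comp hei)
    have e0 : e 0 = c := Subtype.ext (by simp [e])
    have e1 : e 1 = 1 := Subtype.ext (by simp [e])
    simp only [Function.comp_apply, e0, e1, scale_one] at h
    exact ⟨_, h⟩
  have key2 : ∀ x y : F, x ≠ y → (y ≠ t) → (x = t ∨ M.dir x = M.dir y) →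
      M.height x ≤ M.height y → ∃ A, IsArcJoining A x y := by
    intro x y hxy hy hd hh
    have : ∃ c, M.scale c y = x := by
      by_cases hx : x = t
      · exact ⟨0, by rw [hx, scale_zero]⟩
      · obtain ⟨c, -, h⟩ := M.exists_scale_eq hy hx (hd.resolve_left hx) hh
        exact ⟨c, h⟩
    obtain ⟨c, rfl⟩ := this
    exact key y c hy fun h => hxy (by rw [h, scale_one])
  by_cases hx : x = t
  · refine key2 x y hxy (fun h => hxy (hx.trans h.symm)) (Or.inl hx) ?_
    rw [hx, height_top]; exact M.height_nonneg y
  by_cases hy : y = t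
  · obtain ⟨A, hA⟩ := key2 y x hxy.symm hx (Or.inl hy) (by rw [hy, height_top]; exact M.height_nonneg x)
    exact ⟨A, hA.symm⟩
  by_cases hd : M.dir x = M.dir y
  · rcases le_total (M.height x) (M.height y) with h | h
    · exact key2 x y hxy hy (Or.inr hd) h
    · obtain ⟨A, hA⟩ := key2 y x hxy.symm hx (Or.inr hd.symm) h
      exact ⟨A, hA.symm⟩
  -- `e₁` falls from 1 to 0 on the first half and `e₂` rises from 0 to 1 on the second; elsewhere
  -- the projection clamps them to 0.
  let e₁ : unitInterval → unitInterval := fun s => projIcc 0 1 zero_le_one (1 - 2 * (s : ℝ))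
  let e₂ : unitInterval → unitInterval := fun s => projIcc 0 1 zero_le_one (2 * (s : ℝ) - 1)
  have he₁ : Continuous e₁ := continuous_projIcc.comp (by fun_prop)
  have he₂ : Continuous e₂ := continuous_projIcc.comp (by fun_prop)
  have h1 : ∀ s : unitInterval, (s : ℝ) ≤ 1 / 2 → (e₁ s : ℝ) = 1 - 2 * s := fun s hs => by
    have := s.2.1
    simp only [e₁, coe_projIcc]
    rw [min_eq_right (by linarith), max_eq_right (by linarith)]
  have h2 : ∀ s : unitInterval, 1 / 2 ≤ (s : ℝ) → (e₂ s : ℝ) = 2 * s - 1 := fun s hs => by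
    have := s.2.2
    simp only [e₂, coe_projIcc]
    rw [min_eq_right (by linarith), max_eq_right (by linarith)]
  let γ : unitInterval → F := fun s =>
    if (s : ℝ) ≤ 1 / 2 then M.scale (e₁ s) x else M.scale (e₂ s) y
  have hγ : Continuous γ := by
    refine Continuous.if_le ((M.continuous_scale_left x).comp he₁)
      ((M.continuous_scale_left y).comp he₂) (by fun_prop) continuous_const fun s hs => ?_
    have a : e₁ s = 0 := Subtype.ext (by rw [h1 s hs.le, hs]; norm_num)
    have b : e₂ s = 0 := Subtype.ext (by rw [h2 s hs.ge, hs]; norm_num)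
    simp [a, b]
  have hmix : ∀ u v : unitInterval, (u : ℝ) ≤ 1 / 2 → ¬ (v : ℝ) ≤ 1 / 2 → γ u ≠ γ v := by
    intro u v hu hv h
    simp only [γ, hu, hv, if_true, if_false] at h
    have hv0 : e₂ v ≠ 0 := fun h0 => by
      have := h2 v (not_le.1 hv).le
      rw [h0] at this
      simp only [Icc.coe_zero] at this
      exact hv (by linarith)
    have hne := M.scale_ne_top hv0 hy
    have hu0 : e₁ u ≠ 0 := fun h0 => hne (by rw [← h, h0, scale_zero])
    apply hd
    rw [← M.dir_scale _ _ hu0 hx, h, M.dir_scale _ _ hv0 hy]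
  have hγi : Function.Injective γ := by
    intro u v h
    by_cases hu : (u : ℝ) ≤ 1 / 2 <;> by_cases hv : (v : ℝ) ≤ 1 / 2
    · simp only [γ, hu, hv, if_true] at h
      have := congrArg Subtype.val (M.scale_injective hx h)
      rw [h1 u hu, h1 v hv] at this
      exact Subtype.ext (by linarith)
    · exact absurd h (hmix u v hu hv)
    · exact absurd h.symm (hmix v u hv hu)
    · simp only [γ, hu, hv, if_false] at h
      have := congrArg Subtype.val (M.scale_injective hy h)
      rw [h2 u (not_le.1 hu).le, h2 v (not_le.1 hv).le] at this
      exact Subtype.ext (by linarith)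
  have h := isArcJoining_range hγ hγi
  have g0 : γ 0 = x := by
    have : e₁ 0 = 1 := Subtype.ext (by rw [h1 0 (by norm_num)]; simp)
    simp [γ, this]
  have g1 : γ 1 = y := by
    have : e₂ 1 = 1 := Subtype.ext (by rw [h2 1 (by norm_num)]; norm_num)
    simp only [γ, this, scale_one]
    rw [if_neg (by norm_num)]
  rw [g0, g1] at h
  exact ⟨_, h⟩

include M in
theorem top_mem_ramificationPoints
    (h3 : ∃ x y z, x ≠ t ∧ y ≠ t ∧ z ≠ t ∧ M.dir x ≠ M.dir y ∧ M.dir x ≠ M.dir z ∧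
      M.dir y ≠ M.dir z) : t ∈ ramificationPoints F := by
  obtain ⟨x, y, z, hx, hy, hz, hxy, hxz, hyz⟩ := h3
  let e : ℝ → unitInterval := projIcc 0 1 zero_le_one
  have he : Continuous e := continuous_projIcc
  have he0 : ∀ r : ℝ, 0 < r → e r ≠ 0 := fun r hr h => by
    have : (0 : ℝ) = max 0 (min 1 r) := by
      rw [← coe_projIcc 0 1 zero_le_one]; exact (congrArg Subtype.val h).symm
    exact (lt_max_of_lt_right (lt_min one_pos hr)).ne this
  have hz0 : ∀ r : ℝ, r ≤ 0 → e r = 0 := fun r hr => projIcc_of_le_left _ hr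
  have hei : ∀ r s : ℝ, r ∈ Ioc (0:ℝ) 1 → s ∈ Ioc (0:ℝ) 1 → e r = e s → r = s := by
    intro r s hr hs h
    have := congrArg Subtype.val h
    simpa only [e, projIcc_of_mem _ (Ioc_subset_Icc_self hr),
      projIcc_of_mem _ (Ioc_subset_Icc_self hs)] using this
  let g : ℝ × ℝ → F := fun p =>
    if p.2 ≤ 0 then (if p.1 ≤ 0 then M.scale (e (-p.1)) x else M.scale (e p.1) y)
    else M.scale (e p.2) z
  have hx' : ∀ r : ℝ, r ≤ 0 → g (r, 0) = M.scale (e (-r)) x := fun r hr => by simp [g, hr]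
  have hy' : ∀ r : ℝ, 0 ≤ r → g (r, 0) = M.scale (e r) y := fun r hr => by
    rcases hr.eq_or_lt with rfl | hr
    · simp [g, hz0 0 le_rfl]
    · simp [g, hr.not_ge]
  have hz' : ∀ r : ℝ, 0 ≤ r → g (0, r) = M.scale (e r) z := fun r hr => by
    rcases hr.eq_or_lt with rfl | hr
    · simp [g, hz0 0 le_rfl]
    · simp [g, hr.not_ge]
  have htri : triod = (Icc (-1 : ℝ) 0 ×ˢ {(0:ℝ)} ∪ Icc (0 : ℝ) 1 ×ˢ {(0:ℝ)}) ∪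
      {(0:ℝ)} ×ˢ Icc (0:ℝ) 1 := by
    rw [triod, ← union_prod, Icc_union_Icc_eq_Icc (by norm_num) (by norm_num)]
  have hcl1 : IsClosed (Icc (-1 : ℝ) 0 ×ˢ {(0:ℝ)}) := isClosed_Icc.prod isClosed_singleton
  have hcl2 : IsClosed (Icc (0 : ℝ) 1 ×ˢ {(0:ℝ)}) := isClosed_Icc.prod isClosed_singleton
  have hcl3 : IsClosed ({(0:ℝ)} ×ˢ Icc (0:ℝ) 1) := isClosed_singleton.prod isClosed_Icc
  have hgc : ContinuousOn g triod := by
    rw [htri]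
    refine ContinuousOn.union_of_isClosed (ContinuousOn.union_of_isClosed ?_ ?_ hcl1 hcl2) ?_
      (hcl1.union hcl2) hcl3
    · refine ((M.continuous_scale_left x).comp (he.comp (continuous_fst.neg))).continuousOn.congr ?_
      rintro ⟨a, b⟩ ⟨ha, rfl : b = 0⟩
      exact hx' a ha.2
    · refine ((M.continuous_scale_left y).comp (he.comp continuous_fst)).continuousOn.congr ?_
      rintro ⟨a, b⟩ ⟨ha, rfl : b = 0⟩
      exact hy' a ha.1
    · refine ((M.continuous_scale_left z).comp (he.comp continuous_snd)).continuousOn.congr ?_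
      rintro ⟨a, b⟩ ⟨rfl : a = 0, hb⟩
      exact hz' b hb.1
  have hcases : ∀ p ∈ triod, p = (0, 0) ∨
      (∃ r ∈ Ioc (0 : ℝ) 1, p = (-r, 0) ∧ g p = M.scale (e r) x) ∨
      (∃ r ∈ Ioc (0 : ℝ) 1, p = (r, 0) ∧ g p = M.scale (e r) y) ∨
      (∃ r ∈ Ioc (0 : ℝ) 1, p = (0, r) ∧ g p = M.scale (e r) z) := by
    rintro ⟨a, b⟩ (⟨ha, rfl : b = 0⟩ | ⟨rfl : a = 0, hb⟩)
    · simp only at ha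
      rcases lt_trichotomy a 0 with h | rfl | h
      · exact Or.inr (Or.inl ⟨-a, ⟨by linarith, by linarith [ha.1]⟩, by simp, hx' a h.le⟩)
      · exact Or.inl rfl
      · exact Or.inr (Or.inr (Or.inl ⟨a, ⟨h, ha.2⟩, rfl, hy' a h.le⟩))
    · simp only at hb
      rcases hb.1.eq_or_lt with rfl | h
      · exact Or.inl rfl
      · exact Or.inr (Or.inr (Or.inr ⟨b, ⟨h, hb.2⟩, rfl, hz' b h.le⟩))
  have hg0 : g (0, 0) = t := by rw [hx' 0 le_rfl]; simp [hz0 0 le_rfl]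
  have hne : ∀ w, w ≠ t → ∀ r ∈ Ioc (0 : ℝ) 1, M.scale (e r) w ≠ t := fun w hw r hr =>
    M.scale_ne_top (he0 r hr.1) hw
  have hdir : ∀ w w', w ≠ t → w' ≠ t → M.dir w ≠ M.dir w' → ∀ r ∈ Ioc (0 : ℝ) 1,
      ∀ s ∈ Ioc (0 : ℝ) 1, M.scale (e r) w ≠ M.scale (e s) w' := by
    intro w w' hw hw' hd r hr s hs h
    apply hd
    rw [← M.dir_scale _ _ (he0 r hr.1) hw, h, M.dir_scale _ _ (he0 s hs.1) hw']
  have hgi : InjOn g triod := by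
    intro p hp q hq h
    -- Sixteen cases: on one leg scaling is injective, two legs have different directions, and only
    -- the origin goes to `t`.
    rcases hcases p hp with rfl | ⟨r, hr, rfl, h1⟩ | ⟨r, hr, rfl, h1⟩ | ⟨r, hr, rfl, h1⟩ <;>
    rcases hcases q hq with rfl | ⟨s, hs, rfl, h2⟩ | ⟨s, hs, rfl, h2⟩ | ⟨s, hs, rfl, h2⟩ <;>
    first
    | rfl
    | (rw [h1, h2] at h
       first
       | rw [hei r s hr hs (M.scale_injective hx h)]
       | rw [hei r s hr hs (M.scale_injective hy h)]
       | rw [hei r s hr hs (M.scale_injective hz h)]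
       | exact absurd h (hdir _ _ ‹_› ‹_› ‹_› r hr s hs)
       | exact absurd h.symm (hdir _ _ ‹_› ‹_› ‹_› s hs r hr))
    | (rw [h1, hg0] at h; exact absurd h (hne _ ‹_› r hr))
    | (rw [h2, hg0] at h; exact absurd h.symm (hne _ ‹_› s hs))
  have hcpt : IsCompact triod := by
    rw [htri]
    exact ((isCompact_Icc.prod isCompact_singleton).union
      (isCompact_Icc.prod isCompact_singleton)).union (isCompact_singleton.prod isCompact_Icc)
  have : CompactSpace triod := isCompact_iff_compactSpace.1 hcpt
  have hemb : IsEmbedding (triod.domRestrict g) :=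
    ((continuousOn_iff_continuous_domRestrict.1 hgc).isClosedEmbedding
      (injOn_iff_injective.1 hgi)).isEmbedding
  exact ⟨range (triod.domRestrict g), hemb.toHomeomorph, hg0⟩

theorem isSubcontinuum_of_isArc {A : Set F} (hA : IsArc A) : IsSubcontinuum A := by
  obtain ⟨γ, hγ, rfl⟩ := hA.exists_path
  exact ⟨isCompact_range hγ.continuous, isConnected_range hγ.continuous⟩

variable [TotallyDisconnectedSpace D]

/-- The top is interior to any arc joining two directions, and a point below another on its ray is
interior to a longer segment. Conversely, an arc having `e ≠ t` in its interior covers a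
neighbourhood of `e` in its ray, so it rises above `e`. -/
theorem mem_endpoints_iff (h2 : ∃ x y, x ≠ t ∧ y ≠ t ∧ M.dir x ≠ M.dir y) {e : F} :
    e ∈ endpoints F ↔
      e ≠ t ∧ ∀ z, z ≠ t → M.dir z = M.dir e → M.height z ≤ M.height e := by
  constructor
  · intro he
    have het : e ≠ t := by
      rintro rfl
      obtain ⟨x, y, hx, hy, hxy⟩ := h2
      obtain ⟨A, hA⟩ := M.exists_isArcJoining (x := x) (y := y) fun h => hxy (h ▸ rfl)
      have htA : e ∈ A := by
        by_contra htA
        exact hxy (M.dir_eq_of_isPreconnected (isSubcontinuum_of_isArc hA.1).2.2 htA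
          hA.2.2.1.1 hA.2.2.2.1)
      obtain ⟨hA1, hne, hxA, hyA⟩ := hA
      have heA := he A hA1 htA
      obtain ⟨γ, hγ, rfl⟩ := hA1.exists_path
      obtain ⟨u, rfl⟩ := hxA.1
      obtain ⟨v, rfl⟩ := hyA.1
      obtain ⟨w, rfl⟩ := htA
      rw [isArcEndpoint_range_iff hγ] at hxA hyA heA
      rcases hxA with rfl | rfl <;> rcases hyA with rfl | rfl <;> rcases heA with rfl | rfl <;>
        contradiction
    refine ⟨het, fun z hz hd => ?_⟩
    by_contra! hlt
    have hmem : e ∈ M.seg z := (M.mem_seg_iff hz het).2 ⟨hd.symm, hlt.le⟩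
    have h := he (M.seg z) (M.isArcJoining_seg hz).1 hmem
    obtain ⟨c, rfl⟩ := hmem
    have hemb := ((M.continuous_scale_left z).isClosedEmbedding (M.scale_injective hz)).isEmbedding
    rcases (isArcEndpoint_range_iff hemb).1 h with rfl | rfl
    · simp at het
    · simp at hlt
  · rintro ⟨het, hmax⟩ A hA heA
    obtain ⟨γ, hγ, rfl⟩ := hA.exists_path
    obtain ⟨s, rfl⟩ := heA
    rw [isArcEndpoint_range_iff hγ]
    by_contra! hs
    have hs0 : 0 < (s : ℝ) := unitInterval.pos_iff_ne_zero.2 hs.1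
    have hs1 : (s : ℝ) < 1 := unitInterval.lt_one_iff_ne_one.2 hs.2
    let c : ℝ → F := fun r => γ (projIcc 0 1 zero_le_one r)
    have hc : Continuous c := hγ.continuous.comp continuous_projIcc
    have hcs : c s = γ s := by simp [c]
    have hev : ∀ᶠ r in 𝓝 (s : ℝ), c r ≠ t ∧ 0 < r ∧ r < 1 :=
      ((hc.continuousAt.eventually_ne (by rw [hcs]; exact het)).and
        ((lt_mem_nhds hs0).and (gt_mem_nhds hs1)))
    obtain ⟨δ, hδ, hball⟩ := Metric.eventually_nhds_iff.1 hev
    have hin : ∀ u ∈ Icc ((s : ℝ) - δ / 2) (s + δ / 2), c u ≠ t ∧ 0 < u ∧ u < 1 := fun u hu =>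
      hball (by rw [Real.dist_eq, abs_lt]; constructor <;> linarith [hu.1, hu.2])
    have h := M.eventually_exists_height_eq (c := c) (a := s - δ / 2) (b := s + δ / 2) (s := s)
      (by linarith) (by linarith) hc.continuousOn
      (fun u hu v hv huv => by
        have := hγ.injective huv
        have hu' := hin u hu
        have hv' := hin v hv
        rw [projIcc_of_mem _ ⟨hu'.2.1.le, hu'.2.2.le⟩,
          projIcc_of_mem _ ⟨hv'.2.1.le, hv'.2.2.le⟩] at this
        exact congrArg Subtype.val this)
      (fun u hu => (hin u hu).1)
    rw [hcs] at h
    -- The heights covered form a neighbourhood of the height of `e`, so some covered height exceeds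
    -- it.
    obtain ⟨v, ⟨u, hu, hd, hh⟩, hv⟩ := ((h.filter_mono nhdsWithin_le_nhds).and
      (self_mem_nhdsWithin (s := Ioi (M.height (γ s))))).exists
    have := hmax (c u) (hin u hu).1 hd
    rw [hh] at this
    exact this.not_gt hv

-- Near `x ≠ t` the triod lies in a single ray. Its crossbar already covers all heights close to
-- that of `x`, so the third leg has to meet the crossbar a second time.
include M in
theorem not_mem_ramificationPoints {x : F} (hx : x ≠ t) : x ∉ ramificationPoints F := by
  classical
  rintro ⟨T, h, hT⟩
  -- The value off the triod is immaterial.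
  let k : ℝ × ℝ → F := fun p => if hp : p ∈ triod then (h ⟨p, hp⟩ : F) else x
  have hk : ∀ p : triod, k p = h p := fun p => by simp [k]
  have hkc : ContinuousOn k triod := by
    rw [continuousOn_iff_continuous_domRestrict]
    have : triod.domRestrict k = fun p => (h p : F) := funext fun p => hk p
    rw [this]
    exact continuous_subtype_val.comp h.continuous
  have hki : InjOn k triod := fun p hp q hq hpq => by
    have h1 := hk ⟨p, hp⟩
    have h2 := hk ⟨q, hq⟩
    simp only at h1 h2
    rw [h1, h2] at hpq
    exact congrArg Subtype.val (h.injective (Subtype.ext hpq))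
  have hk0 : k (0, 0) = x := by rw [← hT]; exact hk triodTop
  have h1mem : ∀ u : ℝ, u ∈ Icc (-1 : ℝ) 1 → (u, (0 : ℝ)) ∈ triod := fun u hu => Or.inl ⟨hu, rfl⟩
  have h2mem : ∀ u : ℝ, u ∈ Icc (0 : ℝ) 1 → ((0 : ℝ), u) ∈ triod := fun u hu => Or.inr ⟨rfl, hu⟩
  have hev : ∀ᶠ p in 𝓝[triod] ((0, 0) : ℝ × ℝ), k p ≠ t :=
    (hkc (0, 0) origin_mem_triod).eventually_ne (by rw [hk0]; exact hx)
  obtain ⟨ε, hε, hball⟩ := Metric.eventually_nhds_iff.1 (eventually_nhdsWithin_iff.1 hev)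
  set δ := min (ε / 2) 1 with hδdef
  have hδ0 : 0 < δ := lt_min (by linarith) one_pos
  have hδ1 : δ ≤ 1 := min_le_right _ _
  have hδε : δ < ε := (min_le_left _ _).trans_lt (by linarith)
  have ht1 : ∀ u ∈ Icc (-δ) δ, k (u, 0) ≠ t := fun u hu =>
    hball (by
      rw [Prod.dist_eq, max_lt_iff]
      simp only [dist_zero_right, dist_self, Real.norm_eq_abs]
      exact ⟨(abs_le.2 hu).trans_lt hδε, hε⟩) (h1mem u ⟨by linarith [hu.1], by linarith [hu.2]⟩)
  have ht2 : ∀ u ∈ Icc 0 δ, k (0, u) ≠ t := fun u hu =>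
    hball (by
      rw [Prod.dist_eq, max_lt_iff]
      simp only [dist_zero_right, dist_self, Real.norm_eq_abs]
      exact ⟨hε, (abs_le.2 ⟨by linarith [hu.1], hu.2⟩).trans_lt hδε⟩)
      (h2mem u ⟨hu.1, by linarith [hu.2]⟩)
  have hc2 : ContinuousOn (fun u : ℝ => k (0, u)) (Icc 0 δ) :=
    hkc.comp (by fun_prop) fun u hu => h2mem u ⟨hu.1, by linarith [hu.2]⟩
  have h := M.eventually_exists_height_eq (c := fun u => k (u, 0)) (a := -δ) (b := δ) (s := 0)
    (by linarith) hδ0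
    (hkc.comp (by fun_prop) fun u hu => h1mem u ⟨by linarith [hu.1], by linarith [hu.2]⟩)
    (fun u hu v hv huv => congrArg Prod.fst
      (hki (h1mem u ⟨by linarith [hu.1], by linarith [hu.2]⟩)
        (h1mem v ⟨by linarith [hv.1], by linarith [hv.2]⟩) huv)) ht1
  have hcont : ContinuousWithinAt (fun u : ℝ => M.height (k (0, u))) (Icc 0 δ) 0 :=
    (M.continuous_height.comp_continuousOn hc2) 0 ⟨le_rfl, hδ0.le⟩
  have hev2 := (hcont.tendsto.eventually h)
  have hle : 𝓝[Ioc 0 δ] (0 : ℝ) ≤ 𝓝[Icc 0 δ] 0 := nhdsWithin_mono _ Ioc_subset_Icc_self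
  have : (𝓝[Ioc 0 δ] (0 : ℝ)).NeBot := by
    rw [nhdsWithin_Ioc_eq_nhdsGT hδ0]; infer_instance
  obtain ⟨v, ⟨u, hu, hd, hh⟩, hv⟩ := ((hev2.filter_mono hle).and self_mem_nhdsWithin).exists
  have hv' := Ioc_subset_Icc_self hv
  have hdv : M.dir (k (0, v)) = M.dir (k (0, 0)) :=
    M.dir_eq_of_isPreconnected (isPreconnected_Icc.image _ hc2)
      (by rintro ⟨w, hw, h⟩; exact ht2 w hw h) (mem_image_of_mem _ hv')
      (mem_image_of_mem _ ⟨le_rfl, hδ0.le⟩)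
  have heq : k (u, 0) = k (0, v) :=
    M.ext_of_ne _ _ (ht1 u hu) (ht2 v hv') (hd.trans hdv.symm) hh
  have := hki (h1mem u ⟨by linarith [hu.1], by linarith [hu.2]⟩)
    (h2mem v ⟨hv'.1, by linarith [hv'.2]⟩) heq
  exact hv.1.ne (congrArg Prod.snd this)

variable [CompactSpace D] [T2Space D]

/-- If a point `y` of the segment were missing, compactness of the level of `y` in `S` would give a
clopen set `V` of directions around that of `x` which `S` avoids at this level. The part of `S`
above the level with directions in `V` would then split off `x` from `t`. -/
theorem seg_subset_of_isSubcontinuum {S : Set F} (hS : IsSubcontinuum S) (ht : t ∈ S) {x : F}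
    (hx : x ∈ S) : M.seg x ⊆ S := by
  rintro _ ⟨c, rfl⟩
  by_contra hy
  have hxt : x ≠ t := by rintro rfl; exact hy (by simpa using ht)
  have hc0 : c ≠ 0 := by rintro rfl; exact hy (by simpa using ht)
  have hc1 : c ≠ 1 := by rintro rfl; exact hy (by simpa using hx)
  simp only at hy
  set y := M.scale c x with hydef
  have hyt : y ≠ t := M.scale_ne_top hc0 hxt
  have hyd : M.dir y = M.dir x := M.dir_scale _ _ hc0 hxt
  have hyh : M.height y < M.height x := by
    rw [hydef, M.height_scale]
    exact mul_lt_of_lt_one_left (M.height_pos hxt) (unitInterval.lt_one_iff_ne_one.2 hc1)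
  let A : Set F := S ∩ {z | M.height z = M.height y}
  have hAt : A ⊆ {t}ᶜ := fun z hz h => by
    have h1 : M.height z = M.height y := hz.2
    rw [show z = t from h, height_top] at h1
    exact (M.height_pos hyt).ne h1
  have hA : IsCompact A := hS.1.inter_right (isClosed_eq M.continuous_height continuous_const)
  have hAd : IsCompact (M.dir '' A) := hA.image_of_continuousOn (M.continuousOn_dir.mono hAt)
  have hmem : M.dir x ∈ (M.dir '' A)ᶜ := by
    rintro ⟨z, hz, h⟩
    exact hy (M.ext_of_ne z y (hAt hz) hyt (h.trans hyd.symm) hz.2 ▸ hz.1)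
  obtain ⟨V, hV, hxV, hVA⟩ := compact_exists_isClopen_in_isOpen hAd.isClosed.isOpen_compl hmem
  have hopen : ∀ W : Set D, IsOpen W → IsOpen ({t}ᶜ ∩ M.dir ⁻¹' W) := fun W hW =>
    M.continuousOn_dir.isOpen_inter_preimage isOpen_compl_singleton hW
  have hU := hS.2.2 (({t}ᶜ ∩ M.dir ⁻¹' V) ∩ {z | M.height y < M.height z})
    (({t}ᶜ ∩ M.dir ⁻¹' Vᶜ) ∪ {z | M.height z < M.height y})
    ((hopen V hV.isOpen).inter (isOpen_lt continuous_const M.continuous_height))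
    ((hopen _ hV.compl.isOpen).union (isOpen_lt M.continuous_height continuous_const))
    (by
      intro z hz
      rcases lt_trichotomy (M.height z) (M.height y) with h | h | h
      · exact Or.inr (Or.inr h)
      · exact Or.inr (Or.inl ⟨hAt ⟨hz, h⟩, fun hzV => hVA hzV ⟨z, ⟨hz, h⟩, rfl⟩⟩)
      · have hzt : z ≠ t := by
          rintro rfl
          rw [height_top] at h
          exact h.not_ge (M.height_nonneg y)
        by_cases hzV : M.dir z ∈ V
        · exact Or.inl ⟨⟨hzt, hzV⟩, h⟩
        · exact Or.inr (Or.inl ⟨hzt, hzV⟩))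
    ⟨x, hx, ⟨hxt, hxV⟩, hyh⟩
    ⟨t, ht, Or.inr (by simpa using M.height_pos hyt)⟩
  obtain ⟨z, -, ⟨⟨-, hz1⟩, hz2⟩, hz3⟩ := hU
  rcases hz3 with h | h
  · exact h.2 hz1
  · exact lt_asymm hz2 (show M.height z < M.height y from h)

/-- Subcontinua are convex along rays: through the segments if they contain `t`, and otherwise by
the intermediate value theorem for the height on the one ray containing them. -/
theorem mem_of_isSubcontinuum {S : Set F} (hS : IsSubcontinuum S) {p q z : F} (hp : p ∈ S)
    (hq : q ∈ S) (hzt : z ≠ t) (hqt : q ≠ t)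
    (hzp : M.dir z = M.dir p) (hzq : M.dir z = M.dir q)
    (h1 : M.height p ≤ M.height z) (h2 : M.height z ≤ M.height q) : z ∈ S := by
  by_cases ht : t ∈ S
  · exact M.seg_subset_of_isSubcontinuum hS ht hq ((M.mem_seg_iff hqt hzt).2 ⟨hzq, h2⟩)
  · obtain ⟨w, hw, hwz⟩ := (hS.2.2.image M.height M.continuous_height.continuousOn).Icc_subset
      (mem_image_of_mem _ hp) (mem_image_of_mem _ hq) ⟨h1, h2⟩
    have hwt : w ≠ t := fun h => ht (h ▸ hw)
    have hd := M.dir_eq_of_isPreconnected hS.2.2 ht hw hp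
    exact M.ext_of_ne w z hwt hzt (hd.trans hzp.symm) hwz ▸ hw

-- If both sets contain `t`, the intersection is star-shaped. Otherwise one of them misses `t`, so
-- the intersection lies in one ray and is convex there.
include M in
theorem isPreconnected_inter {B C : Set F} (hB : IsSubcontinuum B) (hC : IsSubcontinuum C) :
    IsPreconnected (B ∩ C) := by
  by_cases ht : t ∈ B ∩ C
  · exact isPreconnected_of_forall t fun y hy => ⟨M.seg y,
      subset_inter (M.seg_subset_of_isSubcontinuum hB ht.1 hy.1)
        (M.seg_subset_of_isSubcontinuum hC ht.2 hy.2),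
      M.top_mem_seg y, M.self_mem_seg y, M.isPreconnected_seg y⟩
  · have key : ∀ p ∈ B ∩ C, ∀ q ∈ B ∩ C, M.height p ≤ M.height q →
        ∃ T ⊆ B ∩ C, p ∈ T ∧ q ∈ T ∧ IsPreconnected T := by
      intro p hp q hq hpq
      have hpt : p ≠ t := fun h => ht (h ▸ hp)
      have hqt : q ≠ t := fun h => ht (h ▸ hq)
      have hd : M.dir p = M.dir q := by
        by_cases htB : t ∈ B
        · exact M.dir_eq_of_isPreconnected hC.2.2 (fun h => ht ⟨htB, h⟩) hp.2 hq.2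
        · exact M.dir_eq_of_isPreconnected hB.2.2 htB hp.1 hq.1
      obtain ⟨c, hc0, rfl⟩ := M.exists_scale_eq hqt hpt hd hpq
      have hsub : ∀ d ∈ Icc c 1, ∀ S, IsSubcontinuum S → M.scale c q ∈ S → q ∈ S →
          M.scale d q ∈ S := by
        intro d hd S hS h1 h2
        have hd0 : d ≠ 0 := by
          rintro rfl
          exact hc0 (le_antisymm hd.1 unitInterval.nonneg')
        refine M.mem_of_isSubcontinuum hS h1 h2 (M.scale_ne_top hd0 hqt) hqt ?_ ?_ ?_ ?_
        · rw [M.dir_scale _ _ hd0 hqt, M.dir_scale _ _ hc0 hqt]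
        · rw [M.dir_scale _ _ hd0 hqt]
        · rw [M.height_scale, M.height_scale]
          exact mul_le_mul_of_nonneg_right hd.1 (M.height_nonneg q)
        · rw [M.height_scale]
          exact mul_le_of_le_one_left (M.height_nonneg q) d.2.2
      refine ⟨(fun d => M.scale d q) '' Icc c 1, ?_, ⟨c, ⟨le_rfl, unitInterval.le_one'⟩, rfl⟩,
        ⟨1, ⟨unitInterval.le_one', le_rfl⟩, M.scale_one q⟩,
        isPreconnected_Icc.image _ (M.continuous_scale_left q).continuousOn⟩
      rintro _ ⟨d, hd, rfl⟩
      exact ⟨hsub d hd B hB hp.1 hq.1, hsub d hd C hC hp.2 hq.2⟩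
    refine isPreconnected_of_forall_pair fun p hp q hq => ?_
    rcases le_total (M.height p) (M.height q) with h | h
    · exact key p hp q hq h
    · obtain ⟨T, hT, h1, h2, h3⟩ := key q hq p hp h
      exact ⟨T, hT, h2, h1, h3⟩

include M in
theorem isDendroid [CompactSpace F] : IsDendroid F where
  continuum := ⟨isCompact_univ, M.isConnected_univ⟩
  arcwise_connected _ _ h := M.exists_isArcJoining h
  hereditarily_unicoherent _ _ _ _ hB hC _ := M.isPreconnected_inter hB hC

/-- An arc from `t` to `x` is a subcontinuum, so it contains the segment, and no proper connected
subset of it contains both ends. -/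
theorem arcBetween_top (x : F) : arcBetween t x = M.seg x := by
  unfold arcBetween
  split_ifs with h
  · subst h; exact M.seg_top.symm
  · have hx : x ≠ t := Ne.symm h
    apply Subset.antisymm
    · rintro z ⟨A, hA, hz⟩
      exact hA.subset_of_isPreconnected
        (M.seg_subset_of_isSubcontinuum (isSubcontinuum_of_isArc hA.1) hA.2.2.1.1 hA.2.2.2.1)
        (M.isPreconnected_seg x) (M.top_mem_seg x) (M.self_mem_seg x) hz
    · exact fun z hz => ⟨M.seg x, M.isArcJoining_seg hx, hz⟩

-- Currying makes `y ↦ (c ↦ scale c y)` continuous for the uniform metric, and uniform distance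
-- bounds the Hausdorff distance of the ranges.
include M in
theorem isSmoothAt [CompactSpace F] : IsSmoothAt t := by
  intro x a hxa
  let Φ : F → C(unitInterval, F) := fun y => ⟨fun c => M.scale c y, M.continuous_scale_left y⟩
  have hΦ : Continuous Φ :=
    (ContinuousMap.curry ⟨fun p : F × unitInterval => M.scale p.2 p.1,
      M.continuous_scale.comp continuous_swap⟩).continuous
  have hlim : Tendsto (fun n => dist (Φ (x n)) (Φ a)) atTop (𝓝 0) :=
    (tendsto_iff_dist_tendsto_zero).1 ((hΦ.tendsto a).comp hxa)
  refine squeeze_zero (fun n => Metric.hausdorffDist_nonneg) (fun n => ?_) hlim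
  rw [M.arcBetween_top, M.arcBetween_top]
  refine Metric.hausdorffDist_le_of_mem_dist dist_nonneg ?_ ?_
  · rintro _ ⟨c, rfl⟩
    exact ⟨M.scale c a, ⟨c, rfl⟩, ContinuousMap.dist_apply_le_dist (f := Φ (x n)) (g := Φ a) c⟩
  · rintro _ ⟨c, rfl⟩
    refine ⟨M.scale c (x n), ⟨c, rfl⟩, ?_⟩
    rw [dist_comm]
    exact ContinuousMap.dist_apply_le_dist (f := Φ (x n)) (g := Φ a) c

include M in
theorem isFanWithTop [CompactSpace F]
    (h3 : ∃ x y z, x ≠ t ∧ y ≠ t ∧ z ≠ t ∧ M.dir x ≠ M.dir y ∧ M.dir x ≠ M.dir z ∧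
      M.dir y ≠ M.dir z) : IsFanWithTop F t := by
  refine ⟨M.isDendroid, Subset.antisymm (fun x hx => ?_) ?_⟩
  · by_contra h
    exact M.not_mem_ramificationPoints h hx
  · rw [singleton_subset_iff]
    exact M.top_mem_ramificationPoints h3

end Dendroid

end RadialModel

end Fans

/-! ### Cones with prescribed ray lengths -/

namespace Fans

/-- Data for a cone over a compact space `D`, embedded in `W`, with ray lengths prescribed by a
compact region in `D × ℝ`. -/
structure ConeData (D W : Type*) [TopologicalSpace D] [NormedAddCommGroup W]
    [NormedSpace ℝ W] where
  emb : D → W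
  continuous_emb : Continuous emb
  injective_emb : Function.Injective emb
  region : Set (D × ℝ)
  isCompact_region : IsCompact region
  nonneg_of_mem : ∀ q ∈ region, 0 ≤ q.2
  scale_mem : ∀ x r c, (x, r) ∈ region → 0 ≤ c → c ≤ 1 → (x, c * r) ∈ region
  nonempty_region : region.Nonempty

namespace ConeData

variable {D W : Type*} [TopologicalSpace D] [NormedAddCommGroup W] [NormedSpace ℝ W]
  (C : ConeData D W)

/-- The cone, a star-shaped subset of `ℝ × W`. -/
def cone : Set (ℝ × W) := (fun q : D × ℝ => (q.2, q.2 • C.emb q.1)) '' C.region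

/-- The point of the cone with given direction and height. -/
def point (q : C.region) : C.cone := ⟨(q.1.2, q.1.2 • C.emb q.1.1), mem_image_of_mem _ q.2⟩

theorem point_surjective : Function.Surjective C.point := by
  rintro ⟨_, q, hq, rfl⟩
  exact ⟨⟨q, hq⟩, rfl⟩

theorem continuous_point : Continuous C.point := by
  have := C.continuous_emb
  apply Continuous.subtype_mk
  fun_prop

theorem point_eq_point_iff {q q' : C.region} :
    C.point q = C.point q' ↔ q = q' ∨ (q.1.2 = 0 ∧ q'.1.2 = 0) := by
  constructor
  · intro h
    have h' := congrArg Subtype.val h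
    simp only [point, Prod.mk.injEq] at h'
    obtain ⟨h1, h2⟩ := h'
    by_cases h0 : q.1.2 = 0
    · exact Or.inr ⟨h0, h1 ▸ h0⟩
    · left
      rw [← h1] at h2
      exact Subtype.ext (Prod.ext (C.injective_emb (smul_right_injective W h0 h2)) h1)
  · rintro (rfl | ⟨h1, h2⟩)
    · rfl
    · apply Subtype.ext
      simp [point, h1, h2]

/-- The apex of the cone. -/
def apex : C.cone :=
  ⟨0, by
    obtain ⟨⟨x, r⟩, h⟩ := C.nonempty_region
    exact ⟨(x, 0 * r), C.scale_mem x r 0 h le_rfl zero_le_one, by simp⟩⟩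

theorem point_eq_apex_iff {q : C.region} : C.point q = C.apex ↔ q.1.2 = 0 := by
  constructor
  · intro h
    exact congrArg (fun z : C.cone => z.1.1) h
  · intro h
    apply Subtype.ext
    simp [point, apex, h]

instance : CompactSpace C.cone := by
  have := isCompact_iff_compactSpace.1 C.isCompact_region
  exact ⟨by rw [← C.point_surjective.range_eq]; exact isCompact_range C.continuous_point⟩

theorem isQuotientMap_point : IsQuotientMap C.point := by
  have := isCompact_iff_compactSpace.1 C.isCompact_region
  exact IsQuotientMap.of_surjective_continuous C.point_surjective C.continuous_point

/-- A homeomorphism of the region that preserves the zero level induces one of the cone. -/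
theorem exists_homeomorph (e : C.region ≃ₜ C.region)
    (he : ∀ q : C.region, (e q).1.2 = 0 ↔ q.1.2 = 0) :
    ∃ E : C.cone ≃ₜ C.cone, ∀ q, E (C.point q) = C.point (e q) := by
  have key : ∀ f : C.region ≃ₜ C.region, (∀ q : C.region, (f q).1.2 = 0 ↔ q.1.2 = 0) →
      ∃ g : C.cone → C.cone, Continuous g ∧ ∀ q, g (C.point q) = C.point (f q) := by
    intro f hf
    have hg : ∀ q, (fun z => C.point (f (Function.surjInv C.point_surjective z))) (C.point q) =
        C.point (f q) := by
      intro q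
      rcases C.point_eq_point_iff.1 (Function.surjInv_eq C.point_surjective (C.point q)) with h | ⟨h1, h2⟩
      · simp only [h]
      · exact C.point_eq_point_iff.2 (Or.inr ⟨(hf _).2 h1, (hf _).2 h2⟩)
    refine ⟨fun z => C.point (f (Function.surjInv C.point_surjective z)), ?_, hg⟩
    rw [C.isQuotientMap_point.continuous_iff]
    convert C.continuous_point.comp f.continuous using 1
    exact funext hg
  obtain ⟨g, hg, hg'⟩ := key e he
  obtain ⟨g₂, hg₂, hg₂'⟩ := key e.symm fun q => by
    rw [← he, e.apply_symm_apply]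
  refine ⟨⟨⟨g, g₂, fun z => ?_, fun z => ?_⟩, hg, hg₂⟩, hg'⟩
  · obtain ⟨q, rfl⟩ := C.point_surjective z
    rw [hg', hg₂', e.symm_apply_apply]
  · obtain ⟨q, rfl⟩ := C.point_surjective z
    rw [hg₂', hg', e.apply_symm_apply]

/-- The direction of a point of the cone. -/
noncomputable def direction (z : C.cone) : D := (Function.surjInv C.point_surjective z).1.1

theorem direction_point {q : C.region} (hq : q.1.2 ≠ 0) : C.direction (C.point q) = q.1.1 := by
  rcases C.point_eq_point_iff.1 (Function.surjInv_eq C.point_surjective (C.point q)) with h | ⟨-, h2⟩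
  · rw [direction, h]
  · exact absurd h2 hq

theorem point_scale (q : C.region) (c : unitInterval) :
    (C.point ⟨(q.1.1, c * q.1.2), C.scale_mem _ _ c q.2 c.2.1 c.2.2⟩ : ℝ × W) =
      (c : ℝ) • (C.point q : ℝ × W) := by
  simp [point, mul_smul]

/-- The right side is continuous off the apex and `emb` is a topological embedding when `D` is
compact, so this formula makes the arbitrarily chosen `direction` continuous there. -/
theorem emb_direction {z : C.cone} (hz : z ≠ C.apex) :
    C.emb (C.direction z) = z.1.1⁻¹ • z.1.2 := by
  obtain ⟨q, rfl⟩ := C.point_surjective z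
  have hq : q.1.2 ≠ 0 := fun h => hz (C.point_eq_apex_iff.2 h)
  rw [C.direction_point hq]
  simp [point, smul_smul, hq]

/-- Scaling on the cone. -/
def scale (c : unitInterval) (z : C.cone) : C.cone :=
  ⟨(c : ℝ) • z.1, by
    obtain ⟨q, rfl⟩ := C.point_surjective z
    rw [← C.point_scale]
    exact Subtype.coe_prop _⟩

theorem scale_point (c : unitInterval) (q : C.region) :
    C.scale c (C.point q) = C.point ⟨(q.1.1, c * q.1.2), C.scale_mem _ _ c q.2 c.2.1 c.2.2⟩ :=
  Subtype.ext (C.point_scale q c).symm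

/-- The cone is swept out by its rays. -/
noncomputable def model [CompactSpace D] : RadialModel C.cone D C.apex where
  height z := z.1.1
  dir := C.direction
  scale := C.scale
  continuous_height := by fun_prop
  continuousOn_dir := by
    have hemb := (C.continuous_emb.isClosedEmbedding C.injective_emb).isInducing
    rw [hemb.continuousOn_iff]
    have hne : ∀ z ∈ ({C.apex}ᶜ : Set C.cone), z.1.1 ≠ 0 := by
      intro z hz h
      obtain ⟨q, rfl⟩ := C.point_surjective z
      exact hz (C.point_eq_apex_iff.2 h)
    have : ContinuousOn (fun z : C.cone => z.1.1⁻¹ • z.1.2) {C.apex}ᶜ :=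
      (ContinuousOn.inv₀ (by fun_prop) hne).smul (by fun_prop)
    exact this.congr fun z hz => C.emb_direction hz
  continuous_scale := by
    apply Continuous.subtype_mk
    fun_prop
  height_nonneg z := by
    obtain ⟨q, rfl⟩ := C.point_surjective z
    exact C.nonneg_of_mem _ q.2
  height_eq_zero z := by
    obtain ⟨q, rfl⟩ := C.point_surjective z
    exact C.point_eq_apex_iff.symm
  height_scale c z := rfl
  dir_scale c z hc hz := by
    obtain ⟨q, rfl⟩ := C.point_surjective z
    have hq : q.1.2 ≠ 0 := fun h => hz (C.point_eq_apex_iff.2 h)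
    have hc' : (c : ℝ) ≠ 0 := fun h => hc (Subtype.ext h)
    rw [C.scale_point, C.direction_point hq, C.direction_point (mul_ne_zero hc' hq)]
  ext_of_ne z z' hz hz' hd hh := by
    have h := congrArg C.emb hd
    rw [C.emb_direction hz, C.emb_direction hz', hh] at h
    have h0 : z'.1.1 ≠ 0 := by
      obtain ⟨q, rfl⟩ := C.point_surjective z'
      exact fun h => hz' (C.point_eq_apex_iff.2 h)
    exact Subtype.ext (Prod.ext hh (smul_right_injective W (inv_ne_zero h0) h))

theorem mem_seg_point [CompactSpace D] {x : D} {r s : ℝ} (hr : (x, r) ∈ C.region)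
    (hs : (x, s) ∈ C.region) (h : s ≤ r) : C.point ⟨(x, s), hs⟩ ∈ C.model.seg (C.point ⟨(x, r), hr⟩) := by
  by_cases hs0 : s = 0
  · rw [(C.point_eq_apex_iff (q := ⟨(x, s), hs⟩)).2 hs0]
    exact C.model.top_mem_seg _
  · have hs1 : 0 < s := lt_of_le_of_ne (C.nonneg_of_mem _ hs) (Ne.symm hs0)
    have hr0 : r ≠ 0 := (hs1.trans_le h).ne'
    rw [C.model.mem_seg_iff (fun h => hr0 (C.point_eq_apex_iff.1 h))
      (fun h => hs0 (C.point_eq_apex_iff.1 h))]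
    exact ⟨(C.direction_point (q := ⟨(x, s), hs⟩) hs0).trans
      (C.direction_point (q := ⟨(x, r), hr⟩) hr0).symm, h⟩

theorem mem_seg_point_iff [CompactSpace D] {x : D} {r : ℝ} (hr : (x, r) ∈ C.region) {z : C.cone} :
    z ∈ C.model.seg (C.point ⟨(x, r), hr⟩) ↔
      ∃ s, ∃ hs : (x, s) ∈ C.region, s ≤ r ∧ C.point ⟨(x, s), hs⟩ = z := by
  constructor
  · rintro ⟨c, rfl⟩
    exact ⟨c * r, C.scale_mem _ _ c hr c.2.1 c.2.2,
      mul_le_of_le_one_left (C.nonneg_of_mem _ hr) c.2.2, (C.scale_point c ⟨(x, r), hr⟩).symm⟩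
  · rintro ⟨s, hs, h, rfl⟩
    exact C.mem_seg_point hr hs h

end ConeData

end Fans

/-! ### Bends of the line and their composites -/

namespace Fans

/-- Parameters of the self-similar fan: the relative lengths `y n < 1` of the blades approaching
a given blade. -/
structure BladeLengths where
  b : ℝ
  y : ℕ → ℝ
  b_pos : 0 < b
  b_lt_one : b < 1
  y_pos : ∀ n, 0 < y n
  y_le : ∀ n, y n ≤ b

namespace BladeLengths

variable (L : BladeLengths)

/-- The reparametrization of the `n`-th approaching blade: it maps `[0, 1]` onto `[0, y n]`,
and `[0, b]` onto a short interval. -/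
noncomputable def bendFun (n : ℕ) (s : ℝ) : ℝ := L.y n * max (s / (n + 1)) (1 + (s - 1) / (1 - L.b))

theorem one_sub_b_pos : 0 < 1 - L.b := sub_pos.2 L.b_lt_one

theorem strictMono_bendFun (n : ℕ) : StrictMono (L.bendFun n) := by
  intro s u h
  have hb := L.one_sub_b_pos
  refine mul_lt_mul_of_pos_left (max_lt_max ?_ ?_) (L.y_pos n)
  · gcongr
  · gcongr

theorem continuous_bendFun (n : ℕ) : Continuous (L.bendFun n) := by
  unfold bendFun
  fun_prop

theorem surjective_bendFun (n : ℕ) : Function.Surjective (L.bendFun n) := by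
  have hb := L.one_sub_b_pos
  have hn : (0 : ℝ) < n + 1 := by positivity
  refine (L.continuous_bendFun n).surjective ?_ ?_
  · refine Tendsto.const_mul_atTop (L.y_pos n) ?_
    exact tendsto_atTop_mono (fun s => le_max_left _ _) (tendsto_id.atTop_div_const hn)
  · refine Tendsto.const_mul_atBot (L.y_pos n) ?_
    refine tendsto_atBot.2 fun c => ?_
    filter_upwards [eventually_le_atBot (c * (n + 1)),
      eventually_le_atBot ((c - 1) * (1 - L.b) + 1)] with s h1 h2
    refine max_le ((div_le_iff₀ hn).2 h1) ?_
    have : (s - 1) / (1 - L.b) ≤ c - 1 := (div_le_iff₀ hb).2 (by linarith)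
    linarith

/-- The reparametrization as an order isomorphism. -/
noncomputable def bend (n : ℕ) : ℝ ≃o ℝ :=
  (L.strictMono_bendFun n).orderIsoOfSurjective _ (L.surjective_bendFun n)

theorem bend_apply (n : ℕ) (s : ℝ) :
    L.bend n s = L.y n * max (s / (n + 1)) (1 + (s - 1) / (1 - L.b)) := rfl

theorem bend_zero (n : ℕ) : L.bend n 0 = 0 := by
  have hb := L.one_sub_b_pos
  have h : 1 + (0 - 1) / (1 - L.b) ≤ 0 := by
    have : 1 ≤ 1 / (1 - L.b) := (one_le_div hb).2 (by linarith [L.b_pos])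
    rw [zero_sub, neg_div]; linarith
  rw [bend_apply, zero_div, max_eq_left h, mul_zero]

theorem bend_one (n : ℕ) : L.bend n 1 = L.y n := by
  have hn : (1 : ℝ) / (n + 1) ≤ 1 := (div_le_one (by positivity)).2 (by simp)
  rw [bend_apply, sub_self, zero_div, add_zero, max_eq_right hn, mul_one]

/-- The contraction by `b` that collapses rays over sequences with infinite support. -/
theorem bend_le (n : ℕ) {s : ℝ} (h0 : 0 ≤ s) (h1 : s ≤ 1) : L.bend n s ≤ L.b * s := by
  have hb := L.one_sub_b_pos
  have hmax : max (s / (n + 1)) (1 + (s - 1) / (1 - L.b)) ≤ s := by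
    refine max_le (div_le_self h0 (by simp)) ?_
    have : (s - 1) / (1 - L.b) ≤ s - 1 := by
      rw [div_le_iff₀ hb]
      nlinarith [L.b_pos]
    linarith
  calc L.bend n s ≤ L.y n * s := mul_le_mul_of_nonneg_left hmax (L.y_pos n).le
    _ ≤ L.b * s := mul_le_mul_of_nonneg_right (L.y_le n) h0

/-- At `s = b` the steep branch of the maximum vanishes, leaving slope `y n / (n + 1)` on `[0, b]`.
This forces tips with two or more new indices towards the top. -/
theorem bend_b_le (n : ℕ) : L.bend n L.b ≤ 1 / (n + 1) := by
  have hb := L.one_sub_b_pos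
  have hn : (0 : ℝ) < n + 1 := by positivity
  have h : 1 + (L.b - 1) / (1 - L.b) ≤ L.b / (n + 1) := by
    rw [← neg_sub 1 L.b, neg_div, div_self hb.ne', add_neg_cancel]
    exact div_nonneg L.b_pos.le hn.le
  rw [bend_apply, max_eq_left h, ← mul_div_assoc]
  have := L.y_le n
  have := L.y_pos n
  have := L.b_pos
  have := L.b_lt_one
  gcongr
  nlinarith

/-- Apply the `n`-th reparametrization if the flag is set. -/
noncomputable def step (n : ℕ) (a : Bool) : ℝ ≃o ℝ := if a then L.bend n else OrderIso.refl ℝ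

theorem step_zero (n : ℕ) (a : Bool) : L.step n a 0 = 0 := by
  cases a <;> simp [step, bend_zero]

theorem step_le (n : ℕ) (a : Bool) {s : ℝ} (h0 : 0 ≤ s) (h1 : s ≤ 1) : L.step n a s ≤ s := by
  cases a
  · simp [step]
  · exact (L.bend_le n h0 h1).trans (mul_le_of_le_one_left h0 L.b_lt_one.le)

theorem step_nonneg (n : ℕ) (a : Bool) {s : ℝ} (h0 : 0 ≤ s) : 0 ≤ L.step n a s := by
  rw [← L.step_zero n a]
  exact (L.step n a).monotone h0

/-- The composition of the reparametrizations of the indices `n < N` with `x n = true`. -/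
noncomputable def param : ℕ → (ℕ → Bool) → (ℝ ≃o ℝ)
  | 0, _ => OrderIso.refl ℝ
  | N + 1, x => (L.step N (x N)).trans (param N x)

theorem param_zero_index (x : ℕ → Bool) (s : ℝ) : L.param 0 x s = s := rfl

theorem param_succ (N : ℕ) (x : ℕ → Bool) (s : ℝ) :
    L.param (N + 1) x s = L.param N x (L.step N (x N) s) := rfl

theorem param_apply_zero (N : ℕ) (x : ℕ → Bool) : L.param N x 0 = 0 := by
  induction N with
  | zero => rfl
  | succ N ih => rw [param_succ, step_zero, ih]

theorem param_nonneg (N : ℕ) (x : ℕ → Bool) {s : ℝ} (h0 : 0 ≤ s) : 0 ≤ L.param N x s := by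
  rw [← L.param_apply_zero N x]
  exact (L.param N x).monotone h0

theorem param_symm_nonneg (N : ℕ) (x : ℕ → Bool) {s : ℝ} (h0 : 0 ≤ s) :
    0 ≤ (L.param N x).symm s := by
  rw [OrderIso.le_symm_apply, param_apply_zero]
  exact h0

theorem param_symm_zero (N : ℕ) (x : ℕ → Bool) : (L.param N x).symm 0 = 0 := by
  rw [OrderIso.symm_apply_eq, param_apply_zero]

theorem param_one_pos (N : ℕ) (x : ℕ → Bool) : 0 < L.param N x 1 := by
  rw [← L.param_apply_zero N x]
  exact (L.param N x).strictMono one_pos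

theorem param_anti {N M : ℕ} (h : N ≤ M) (x : ℕ → Bool) {s : ℝ} (h0 : 0 ≤ s) (h1 : s ≤ 1) :
    L.param M x s ≤ L.param N x s := by
  induction M, h using Nat.le_induction generalizing s with
  | base => rfl
  | succ M _ ih =>
    rw [param_succ]
    have h := L.step_le M (x M) h0 h1
    exact (ih (L.step_nonneg M _ h0) (h.trans h1)).trans ((L.param N x).monotone h)

theorem param_congr {N : ℕ} {x z : ℕ → Bool} (h : ∀ n < N, x n = z n) :
    L.param N x = L.param N z := by
  induction N with
  | zero => rfl
  | succ N ih =>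
    ext s
    rw [param_succ, param_succ, h N (Nat.lt_succ_self N), ih fun n hn => h n (hn.trans (Nat.lt_succ_self N))]

/-- If two sequences agree from `N` on, the compositions differ only in their first `N` terms. -/
theorem param_symm_param {N M : ℕ} (h : N ≤ M) {x z : ℕ → Bool} (hxz : ∀ n ≥ N, x n = z n)
    (s : ℝ) : (L.param N x).symm (L.param M x s) = (L.param N z).symm (L.param M z s) := by
  induction M, h using Nat.le_induction generalizing s with
  | base => simp
  | succ M hM ih => rw [param_succ, param_succ, hxz M hM, ih]

theorem param_eq_of_le {N M : ℕ} (h : N ≤ M) {x : ℕ → Bool} (hx : ∀ n ≥ N, x n = false) (s : ℝ) :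
    L.param M x s = L.param N x s := by
  induction M, h using Nat.le_induction generalizing s with
  | base => rfl
  | succ M hM ih => rw [param_succ, hx M hM, ← ih]; rfl

theorem exists_param_le_pow {x : ℕ → Bool} (hx : ∀ N, ∃ n ≥ N, x n = true) (k : ℕ) :
    ∃ N, ∀ s, 0 ≤ s → s ≤ 1 → L.param N x s ≤ L.b ^ k * s := by
  induction k with
  | zero => exact ⟨0, fun s _ _ => by rw [param_zero_index]; simp⟩
  | succ k ih =>
    obtain ⟨N, hN⟩ := ih
    obtain ⟨n, hn, hxn⟩ := hx N
    refine ⟨n + 1, fun s h0 h1 => ?_⟩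
    rw [param_succ, hxn]
    have ha := L.step_nonneg n true h0
    have hb := L.step_le n true h0 h1
    calc L.param n x (L.step n true s) ≤ L.param N x (L.step n true s) :=
          L.param_anti hn x ha (hb.trans h1)
      _ ≤ L.b ^ k * L.step n true s := hN _ ha (hb.trans h1)
      _ ≤ L.b ^ k * (L.b * s) :=
          mul_le_mul_of_nonneg_left (L.bend_le n h0 h1) (pow_nonneg L.b_pos.le k)
      _ = L.b ^ (k + 1) * s := by ring

theorem eventually_eq_false_of_pos {x : ℕ → Bool} {r : ℝ} (hr : 0 < r)
    (h : ∀ N, r ≤ L.param N x 1) : ∃ N, ∀ n ≥ N, x n = false := by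
  by_contra! hx
  obtain ⟨k, hk⟩ := exists_pow_lt_of_lt_one hr L.b_lt_one
  obtain ⟨N, hN⟩ := L.exists_param_le_pow (x := x) (by simpa using hx) k
  have := hN 1 zero_le_one le_rfl
  linarith [h N]

theorem continuous_step (n : ℕ) : Continuous fun q : Bool × ℝ => L.step n q.1 q.2 :=
  continuous_prod_of_discrete_left.2 fun a => (L.step n a).continuous

theorem continuous_step_symm (n : ℕ) : Continuous fun q : Bool × ℝ => (L.step n q.1).symm q.2 :=
  continuous_prod_of_discrete_left.2 fun a => (L.step n a).symm.continuous

theorem continuous_param (N : ℕ) : Continuous fun q : (ℕ → Bool) × ℝ => L.param N q.1 q.2 := by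
  induction N with
  | zero => exact continuous_snd
  | succ N ih =>
    exact ih.comp (continuous_fst.prodMk ((L.continuous_step N).comp
      (((continuous_apply N).comp continuous_fst).prodMk continuous_snd)))

theorem continuous_param_symm (N : ℕ) :
    Continuous fun q : (ℕ → Bool) × ℝ => (L.param N q.1).symm q.2 := by
  induction N with
  | zero => exact continuous_snd
  | succ N ih =>
    exact (L.continuous_step_symm N).comp
      (((continuous_apply N).comp continuous_fst).prodMk ih)

/-- A finite sequence with a new entry `n` above the others. -/
theorem param_update {N n : ℕ} (hn : N ≤ n) {x : ℕ → Bool} (hx : ∀ m ≥ N, x m = false) :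
    L.param (n + 1) (Function.update x n true) 1 = L.param N x (L.y n) := by
  rw [param_succ, Function.update_self, ← L.param_eq_of_le hn hx,
    L.param_congr (z := x) fun m hm => Function.update_of_ne hm.ne _ _]
  exact congrArg _ (L.bend_one n)

/-- The relative height of a tip near a given blade: it is close to that of a child, or small. -/
theorem param_symm_near {N M K : ℕ} (hNM : N ≤ M) {x z : ℕ → Bool}
    (hx : ∀ n ≥ N, x n = false) (hz : ∀ n ≥ K, z n = false) (hxz : ∀ n < M, z n = x n)
    (hne : z ≠ x) :
    ∃ n ≥ M, (L.param N x).symm (L.param K z 1) = L.y n ∨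
      (L.param N x).symm (L.param K z 1) ≤ L.bend n L.b := by
  classical
  have hex : ∃ n, M ≤ n ∧ z n = true := by
    by_contra! h
    refine hne (funext fun n => ?_)
    by_cases hn : n < M
    · exact hxz n hn
    · rw [hx n (by omega)]; simpa using h n (by omega)
  -- The first index at which `z` departs from `x`.
  set n := Nat.find hex with hndef
  obtain ⟨hnM, hzn⟩ := Nat.find_spec hex
  have hmin : ∀ m < n, M ≤ m → z m = false := fun m hm hMm => by
    have := Nat.find_min hex hm
    simpa [hMm] using this
  have hzx : ∀ m < n, z m = x m := fun m hm => by
    by_cases h : m < M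
    · exact hxz m h
    · rw [hmin m hm (by omega), hx m (by omega)]
  have hbase : ∀ s, L.param (n + 1) z s = L.param N x (L.bend n s) := fun s => by
    rw [param_succ, hzn, L.param_congr hzx, L.param_eq_of_le (hNM.trans hnM) hx]
    rfl
  have hK : n < K := by
    by_contra! h
    rw [hz n h] at hzn
    exact absurd hzn (by simp)
  refine ⟨n, hnM, ?_⟩
  -- A further index `m` sends 1 to `y m ≤ b` before the `n`-th bend is applied.
  by_cases hmore : ∃ m, n < m ∧ z m = true
  · right
    obtain ⟨m, hnm, hzm⟩ := hmore
    have hmK : m < K := by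
      by_contra! h
      rw [hz m h] at hzm
      exact absurd hzm (by simp)
    rw [OrderIso.symm_apply_le, ← hbase]
    calc L.param K z 1 ≤ L.param (m + 1) z 1 := L.param_anti hmK z zero_le_one le_rfl
      _ = L.param m z (L.y m) := by rw [param_succ, hzm, ← L.bend_one m]; rfl
      _ ≤ L.param m z L.b := (L.param m z).monotone (L.y_le m)
      _ ≤ L.param (n + 1) z L.b := L.param_anti hnm z L.b_pos.le L.b_lt_one.le
  · left
    rw [OrderIso.symm_apply_eq, ← L.bend_one n, ← hbase]
    refine L.param_eq_of_le hK (fun m hm => ?_) 1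
    by_contra h
    exact hmore ⟨m, hm, by simpa using h⟩

end BladeLengths

end Fans

/-! ### The fan over binary sequences: endpoints, homogeneity and the EPG property -/

namespace Fans

/-- Translation by `g` in the group of binary sequences. -/
def xorHomeomorph (g : ℕ → Bool) : (ℕ → Bool) ≃ₜ (ℕ → Bool) where
  toFun x n := xor (x n) (g n)
  invFun x n := xor (x n) (g n)
  left_inv x := by ext n; simp
  right_inv x := by ext n; simp
  continuous_toFun := continuous_pi fun n =>
    (continuous_of_discreteTopology (f := fun a => xor a (g n))).comp (continuous_apply n)
  continuous_invFun := continuous_pi fun n =>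
    (continuous_of_discreteTopology (f := fun a => xor a (g n))).comp (continuous_apply n)

@[simp] theorem xorHomeomorph_apply (g x : ℕ → Bool) (n : ℕ) :
    xorHomeomorph g x n = xor (x n) (g n) := rfl

theorem xorHomeomorph_self (x z : ℕ → Bool) : xorHomeomorph (fun n => xor (x n) (z n)) x = z := by
  ext n
  simp

theorem tendsto_update_nhds (x : ℕ → Bool) {n : ℕ → ℕ} (hn : Tendsto n atTop atTop)
    (a : ℕ → Bool) : Tendsto (fun k => Function.update x (n k) (a k)) atTop (𝓝 x) := by
  rw [tendsto_pi_nhds]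
  intro m
  refine tendsto_const_nhds.congr' ?_
  filter_upwards [hn.eventually_gt_atTop m] with k hk
  rw [Function.update_of_ne hk.ne]

namespace BladeLengths

variable (L : BladeLengths)

theorem param_one_unique {N M : ℕ} {x : ℕ → Bool} (hN : ∀ n ≥ N, x n = false)
    (hM : ∀ n ≥ M, x n = false) : L.param N x 1 = L.param M x 1 := by
  rcases le_total N M with h | h
  · exact (L.param_eq_of_le h hN 1).symm
  · exact L.param_eq_of_le h hM 1

variable {P : Type*} [TopologicalSpace P] [CompactSpace P] [Nonempty P] {j : P → ℝ}
  (hj : Continuous j) (hi : Function.Injective j)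

/-- The cone over binary sequences times `P` in which the ray over `(x, p)` has positive length
exactly when `x` is finitely supported. -/
noncomputable def coneData : ConeData ((ℕ → Bool) × P) (ℝ × ℝ) where
  emb q := (cantorSetHomeomorphNatToBool.symm q.1, j q.2)
  continuous_emb := by
    have := cantorSetHomeomorphNatToBool.symm.continuous
    fun_prop
  injective_emb := by
    intro q q' h
    obtain ⟨h1, h2⟩ := Prod.mk.inj h
    exact Prod.ext (cantorSetHomeomorphNatToBool.symm.injective (Subtype.ext h1)) (hi h2)
  region := {q | 0 ≤ q.2 ∧ ∀ N, q.2 ≤ L.param N q.1.1 1}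
  isCompact_region := by
    refine ((isCompact_univ (X := (ℕ → Bool) × P)).prod
      (isCompact_Icc (a := (0 : ℝ)) (b := 1))).of_isClosed_subset ?_ ?_
    · rw [ofPred_and, ofPred_forall]
      refine (isClosed_le continuous_const continuous_snd).inter (isClosed_iInter fun N => ?_)
      exact isClosed_le continuous_snd
        ((L.continuous_param N).comp ((continuous_fst.comp continuous_fst).prodMk continuous_const))
    -- The condition for `N = 0` is `q.2 ≤ 1`, as `param 0` is the identity.
    · exact fun q hq => ⟨trivial, hq.1, hq.2 0⟩
  nonneg_of_mem q hq := hq.1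
  scale_mem x r c hr h0 h1 := ⟨mul_nonneg h0 hr.1, fun N =>
    (mul_le_of_le_one_left hr.1 h1).trans (hr.2 N)⟩
  nonempty_region := ⟨((fun _ => false, Classical.arbitrary P), 0), le_rfl, fun N =>
    (L.param_one_pos N _).le⟩

theorem param_mem_region {N : ℕ} {x : ℕ → Bool} (hx : ∀ n ≥ N, x n = false) (p : P) {s : ℝ}
    (h0 : 0 ≤ s) (h1 : s ≤ 1) : ((x, p), L.param N x s) ∈ (L.coneData hj hi).region := by
  refine ⟨L.param_nonneg N x h0, fun M => ?_⟩
  refine ((L.param N x).monotone h1).trans ?_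
  rcases le_total N M with h | h
  · exact (L.param_eq_of_le h hx 1).ge
  · exact L.param_anti h x zero_le_one le_rfl

/-- The point over `(x, p)` with relative height `s`. -/
noncomputable def bladePoint {N : ℕ} {x : ℕ → Bool} (hx : ∀ n ≥ N, x n = false) (p : P)
    (s : unitInterval) : (L.coneData hj hi).cone :=
  (L.coneData hj hi).point ⟨((x, p), L.param N x s), L.param_mem_region hj hi hx p s.2.1 s.2.2⟩

theorem bladePoint_ne_apex {N : ℕ} {x : ℕ → Bool} (hx : ∀ n ≥ N, x n = false) (p : P)
    {s : unitInterval} (hs : s ≠ 0) : L.bladePoint hj hi hx p s ≠ (L.coneData hj hi).apex := by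
  intro h
  have h1 : L.param N x s = 0 := (L.coneData hj hi).point_eq_apex_iff.1 h
  rw [← L.param_apply_zero N x] at h1
  exact hs (Subtype.ext ((L.param N x).injective h1))

theorem bladePoint_zero {N : ℕ} {x : ℕ → Bool} (hx : ∀ n ≥ N, x n = false) (p : P) :
    L.bladePoint hj hi hx p 0 = (L.coneData hj hi).apex :=
  (L.coneData hj hi).point_eq_apex_iff.2 (L.param_apply_zero N x)

theorem dir_bladePoint {N : ℕ} {x : ℕ → Bool} (hx : ∀ n ≥ N, x n = false) (p : P)
    {s : unitInterval} (hs : s ≠ 0) :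
    (L.coneData hj hi).model.dir (L.bladePoint hj hi hx p s) = (x, p) :=
  (L.coneData hj hi).direction_point fun h =>
    L.bladePoint_ne_apex hj hi hx p hs ((L.coneData hj hi).point_eq_apex_iff.2 h)

theorem height_bladePoint {N : ℕ} {x : ℕ → Bool} (hx : ∀ n ≥ N, x n = false) (p : P)
    (s : unitInterval) :
    (L.coneData hj hi).model.height (L.bladePoint hj hi hx p s) = L.param N x s := rfl

theorem bladePoint_one_unique {N M : ℕ} {x : ℕ → Bool} (hx : ∀ n ≥ N, x n = false)
    (hx' : ∀ n ≥ M, x n = false) (p : P) :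
    L.bladePoint hj hi hx p 1 = L.bladePoint hj hi hx' p 1 :=
  congrArg (L.coneData hj hi).point
    (Subtype.ext (Prod.ext rfl (L.param_one_unique hx hx')))

theorem continuous_bladePoint {N : ℕ} {x : ℕ → Bool} (hx : ∀ n ≥ N, x n = false) :
    Continuous fun q : P × unitInterval => L.bladePoint hj hi hx q.1 q.2 := by
  refine (L.coneData hj hi).continuous_point.comp (Continuous.subtype_mk ?_ _)
  have := (L.param N x).continuous
  fun_prop

theorem exists_three_directions : ∃ u v w, u ≠ (L.coneData hj hi).apex ∧
    v ≠ (L.coneData hj hi).apex ∧ w ≠ (L.coneData hj hi).apex ∧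
    (L.coneData hj hi).model.dir u ≠ (L.coneData hj hi).model.dir v ∧
    (L.coneData hj hi).model.dir u ≠ (L.coneData hj hi).model.dir w ∧
    (L.coneData hj hi).model.dir v ≠ (L.coneData hj hi).model.dir w := by
  let p := Classical.arbitrary P
  have hx : ∀ n ≥ 2, (fun _ => false : ℕ → Bool) n = false := fun _ _ => rfl
  have hy : ∀ n ≥ 2, (fun n => decide (n = 0) : ℕ → Bool) n = false := fun n hn => by
    simp; omega
  have hz : ∀ n ≥ 2, (fun n => decide (n = 1) : ℕ → Bool) n = false := fun n hn => by
    simp; omega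
  refine ⟨L.bladePoint hj hi hx p 1, L.bladePoint hj hi hy p 1, L.bladePoint hj hi hz p 1,
    L.bladePoint_ne_apex hj hi hx p one_ne_zero, L.bladePoint_ne_apex hj hi hy p one_ne_zero,
    L.bladePoint_ne_apex hj hi hz p one_ne_zero, ?_, ?_, ?_⟩ <;>
  rw [dir_bladePoint _ _ _ _ _ one_ne_zero, dir_bladePoint _ _ _ _ _ one_ne_zero] <;>
  intro h
  · simpa using congrFun (congrArg Prod.fst h) 0
  · simpa using congrFun (congrArg Prod.fst h) 1
  · simpa using congrFun (congrArg Prod.fst h) 0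

theorem mem_seg_bladePoint_one_iff {N : ℕ} {x : ℕ → Bool} (hx : ∀ n ≥ N, x n = false) (p : P)
    {z : (L.coneData hj hi).cone} :
    z ∈ (L.coneData hj hi).model.seg (L.bladePoint hj hi hx p 1) ↔
      ∃ s, L.bladePoint hj hi hx p s = z := by
  unfold bladePoint
  rw [ConeData.mem_seg_point_iff]
  constructor
  · rintro ⟨r, hr, h, rfl⟩
    refine ⟨⟨(L.param N x).symm r, L.param_symm_nonneg N x hr.1,
      (OrderIso.symm_apply_le _).2 h⟩, ?_⟩
    congr 3
    exact (L.param N x).apply_symm_apply r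
  · rintro ⟨s, rfl⟩
    exact ⟨_, _, (L.param N x).monotone s.2.2, rfl⟩

/-- Positive height forces finite support, and then the decreasing bounds stabilize at `param N x
1`, which is attained. -/
theorem mem_endpoints_cone_iff [T2Space P] [TotallyDisconnectedSpace P]
    {e : (L.coneData hj hi).cone} : e ∈ endpoints (L.coneData hj hi).cone ↔
      ∃ (N : ℕ) (x : ℕ → Bool) (hx : ∀ n ≥ N, x n = false) (p : P),
        L.bladePoint hj hi hx p 1 = e := by
  obtain ⟨u, v, w, hu, hv, -, huv, -⟩ := L.exists_three_directions hj hi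
  rw [(L.coneData hj hi).model.mem_endpoints_iff ⟨u, v, hu, hv, huv⟩]
  constructor
  · rintro ⟨he, hmax⟩
    obtain ⟨⟨⟨⟨x, p⟩, r⟩, hr⟩, rfl⟩ := (L.coneData hj hi).point_surjective e
    have hr0 : r ≠ 0 := fun h => he ((L.coneData hj hi).point_eq_apex_iff.2 h)
    obtain ⟨N, hN⟩ := L.eventually_eq_false_of_pos (lt_of_le_of_ne hr.1 hr0.symm) hr.2
    have h := hmax (L.bladePoint hj hi hN p 1) (L.bladePoint_ne_apex hj hi hN p one_ne_zero)
      ((L.dir_bladePoint hj hi hN p one_ne_zero).trans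
        ((L.coneData hj hi).direction_point (q := ⟨((x, p), r), hr⟩) hr0).symm)
    refine ⟨N, x, hN, p, ?_⟩
    exact congrArg (L.coneData hj hi).point
      (Subtype.ext (Prod.ext rfl (le_antisymm h (hr.2 N))))
  · rintro ⟨N, x, hx, p, rfl⟩
    refine ⟨L.bladePoint_ne_apex hj hi hx p one_ne_zero, fun z hz hd => ?_⟩
    obtain ⟨⟨⟨⟨x', p'⟩, r⟩, hr⟩, rfl⟩ := (L.coneData hj hi).point_surjective z
    have hr0 : r ≠ 0 := fun h => hz ((L.coneData hj hi).point_eq_apex_iff.2 h)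
    rw [L.dir_bladePoint hj hi hx p one_ne_zero] at hd
    have hd' : (x', p') = (x, p) :=
      ((L.coneData hj hi).direction_point (q := ⟨((x', p'), r), hr⟩) hr0).symm.trans hd
    obtain ⟨rfl, rfl⟩ := Prod.mk.inj hd'
    exact hr.2 N

/-- The self-map of the region induced by a translation of the sequences and a map of `P`. -/
noncomputable def translate (g : ℕ → Bool) (N : ℕ) (τ : P ≃ₜ P) (q : ((ℕ → Bool) × P) × ℝ) :
    ((ℕ → Bool) × P) × ℝ :=
  ((xorHomeomorph g q.1.1, τ q.1.2),
    L.param N (xorHomeomorph g q.1.1) ((L.param N q.1.1).symm q.2))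

omit [CompactSpace P] [Nonempty P] in
theorem continuous_translate (g : ℕ → Bool) (N : ℕ) (τ : P ≃ₜ P) :
    Continuous (L.translate g N τ) := by
  have h1 := (xorHomeomorph g).continuous
  have h2 := τ.continuous
  have h3 := L.continuous_param N
  have h4 := L.continuous_param_symm N
  refine Continuous.prodMk (by fun_prop) ?_
  have h5 : Continuous fun q : ((ℕ → Bool) × P) × ℝ => (q.1.1, q.2) := by fun_prop
  have h6 : Continuous fun q : ((ℕ → Bool) × P) × ℝ => xorHomeomorph g q.1.1 := by fun_prop
  exact h3.comp (h6.prodMk (h4.comp h5))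

omit [CompactSpace P] [Nonempty P] in
theorem translate_translate (g : ℕ → Bool) (N : ℕ) (τ : P ≃ₜ P) (q : ((ℕ → Bool) × P) × ℝ) :
    L.translate g N τ.symm (L.translate g N τ q) = q := by
  have h : xorHomeomorph g (xorHomeomorph g q.1.1) = q.1.1 :=
    (xorHomeomorph g).symm_apply_apply q.1.1
  simp [translate, h]

/-- As `g` vanishes from `N` on, a sequence and its translate have the same factors after the first
`N`. Exchanging those first factors turns the bound for `M ≥ N` into the translated bound; smaller
`M` follow by monotonicity. -/
theorem translate_mem_region {g : ℕ → Bool} {N : ℕ} (hg : ∀ n ≥ N, g n = false) (τ : P ≃ₜ P)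
    {q : ((ℕ → Bool) × P) × ℝ} (hq : q ∈ (L.coneData hj hi).region) :
    L.translate g N τ q ∈ (L.coneData hj hi).region := by
  refine ⟨L.param_nonneg _ _ (L.param_symm_nonneg _ _ hq.1), ?_⟩
  have key : ∀ M ≥ N, (L.translate g N τ q).2 ≤ L.param M (L.translate g N τ q).1.1 1 := by
    intro M hM
    have h := L.param_symm_param hM (x := q.1.1) (z := xorHomeomorph g q.1.1)
      (fun n hn => by simp [hg n hn]) 1
    calc (L.translate g N τ q).2
        ≤ L.param N (xorHomeomorph g q.1.1) ((L.param N q.1.1).symm (L.param M q.1.1 1)) :=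
          (L.param N _).monotone ((L.param N q.1.1).symm.monotone (hq.2 M))
      _ = L.param M (xorHomeomorph g q.1.1) 1 := by rw [h, OrderIso.apply_symm_apply]
  intro M
  exact (key (max N M) (le_max_left _ _)).trans
    (L.param_anti (le_max_right _ _) _ zero_le_one le_rfl)

theorem endpointHomogeneous_cone [T2Space P] [TotallyDisconnectedSpace P]
    (hP : ∀ p p' : P, ∃ τ : P ≃ₜ P, τ p = p') :
    EndpointHomogeneous (L.coneData hj hi).cone := by
  intro e he e' he'
  rw [mem_endpoints_cone_iff] at he he'
  obtain ⟨N₁, x, hx₁, p, rfl⟩ := he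
  obtain ⟨N₂, x', hx₂, p', rfl⟩ := he'
  obtain ⟨τ, rfl⟩ := hP p p'
  set N := max N₁ N₂
  have hx : ∀ n ≥ N, x n = false := fun n hn => hx₁ n ((le_max_left _ _).trans hn)
  have hx' : ∀ n ≥ N, x' n = false := fun n hn => hx₂ n ((le_max_right _ _).trans hn)
  rw [L.bladePoint_one_unique hj hi hx₁ hx, L.bladePoint_one_unique hj hi hx₂ hx']
  set g : ℕ → Bool := fun n => xor (x n) (x' n)
  have hg : ∀ n ≥ N, g n = false := fun n hn => by simp [g, hx n hn, hx' n hn]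
  let E : (L.coneData hj hi).region ≃ₜ (L.coneData hj hi).region :=
    { toFun := fun q => ⟨_, L.translate_mem_region hj hi hg τ q.2⟩
      invFun := fun q => ⟨_, L.translate_mem_region hj hi hg τ.symm q.2⟩
      left_inv := fun q => Subtype.ext (L.translate_translate g N τ q)
      right_inv := fun q => Subtype.ext (L.translate_translate g N τ.symm q)
      continuous_toFun := ((L.continuous_translate g N τ).comp continuous_subtype_val).subtype_mk _
      continuous_invFun :=
        ((L.continuous_translate g N τ.symm).comp continuous_subtype_val).subtype_mk _ }
  obtain ⟨F, hF⟩ := (L.coneData hj hi).exists_homeomorph E fun q => by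
    change L.param N _ ((L.param N _).symm q.1.2) = 0 ↔ _
    rw [← OrderIso.eq_symm_apply, param_symm_zero, OrderIso.symm_apply_eq, param_apply_zero]
  refine ⟨F, (hF _).trans (congrArg _ (Subtype.ext ?_))⟩
  change L.translate g N τ ((x, p), L.param N x 1) = ((x', τ p), L.param N x' 1)
  simp only [translate, OrderIso.symm_apply_apply]
  rw [show xorHomeomorph g x = x' from xorHomeomorph_self x x']

section EPG

variable [T2Space P] [TotallyDisconnectedSpace P] {Z : Set unitInterval}

/-- For `s ≠ 1`, setting one further entry `n` with `y n` close to `s` gives tips converging to the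
point. For `s = 1`, the tips over `(x, p')` with `p' → p` do. -/
theorem bladePoint_mem_closure {N : ℕ} {x : ℕ → Bool} (hx : ∀ n ≥ N, x n = false) (p : P)
    (hy : ∀ s ∈ Z, s ≠ 1 → ∀ K : ℕ, ∀ δ > 0, ∃ n ≥ K, |L.y n - s| < δ)
    (hP : 1 ∈ Z → ∀ p : P, (𝓝[≠] p).NeBot) {s : unitInterval} (hs : s ∈ Z) :
    L.bladePoint hj hi hx p s ∈ closure (endpoints (L.coneData hj hi).cone \
      (L.coneData hj hi).model.seg (L.bladePoint hj hi hx p 1)) := by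
  have hout : ∀ {M : ℕ} {z : ℕ → Bool} (hz : ∀ n ≥ M, z n = false) (p' : P), (z, p') ≠ (x, p) →
      L.bladePoint hj hi hz p' 1 ∈ endpoints (L.coneData hj hi).cone \
        (L.coneData hj hi).model.seg (L.bladePoint hj hi hx p 1) := by
    intro M z hz p' hne
    refine ⟨(L.mem_endpoints_cone_iff hj hi).2 ⟨M, z, hz, p', rfl⟩, fun h => hne ?_⟩
    have h1 := L.bladePoint_ne_apex hj hi hz p' one_ne_zero
    rw [RadialModel.mem_seg_iff _ (L.bladePoint_ne_apex hj hi hx p one_ne_zero) h1,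
      dir_bladePoint _ _ _ _ _ one_ne_zero, dir_bladePoint _ _ _ _ _ one_ne_zero] at h
    exact h.1
  by_cases hs1 : s = 1
  · subst hs1
    have := hP hs p
    have hc : Continuous fun p' : P => L.bladePoint hj hi hx p' 1 :=
      (L.continuous_bladePoint hj hi hx).comp
        (by fun_prop : Continuous fun p' : P => (p', (1 : unitInterval)))
    refine mem_closure_of_tendsto ((hc.tendsto p).mono_left nhdsWithin_le_nhds)
      (b := 𝓝[≠] p) ?_
    filter_upwards [self_mem_nhdsWithin] with p' hp'
    exact hout hx p' fun h => hp' (congrArg Prod.snd h)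
  · have hch : ∀ k : ℕ, ∃ n ≥ max N k, |L.y n - s| < 1 / (k + 1) := fun k =>
      hy s hs hs1 _ _ (by positivity)
    choose n hn hns using hch
    have hx' : ∀ k, ∀ m ≥ n k + 1, Function.update x (n k) true m = false := fun k m hm => by
      rw [Function.update_of_ne (by omega)]
      exact hx m (by have := hn k; have := le_max_left N k; omega)
    have hlim : Tendsto (fun k => L.bladePoint hj hi (hx' k) p 1) atTop
        (𝓝 (L.bladePoint hj hi hx p s)) := by
      refine ((L.coneData hj hi).continuous_point.tendsto _).comp (tendsto_subtype_rng.2 ?_)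
      have hnt : Tendsto n atTop atTop :=
        tendsto_atTop_mono (fun k => (le_max_right N k).trans (hn k)) tendsto_id
      refine Tendsto.prodMk_nhds
        ((tendsto_update_nhds x hnt fun _ => true).prodMk_nhds tendsto_const_nhds) ?_
      have hyl : Tendsto (fun k => L.y (n k)) atTop (𝓝 (s : ℝ)) := by
        rw [tendsto_iff_dist_tendsto_zero]
        exact squeeze_zero (fun _ => dist_nonneg) (fun k => (hns k).le)
          tendsto_one_div_add_atTop_nhds_zero_nat
      refine (((L.param N x).continuous.tendsto (s : ℝ)).comp hyl).congr fun k => ?_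
      exact (L.param_update ((le_max_left N k).trans (hn k)) hx).symm
    refine mem_closure_of_tendsto hlim (Eventually.of_forall fun k => hout (hx' k) p fun h => ?_)
    have h1 := congrFun (congrArg Prod.fst h) (n k)
    simp only [Function.update_self] at h1
    rw [hx _ ((le_max_left N k).trans (hn k))] at h1
    exact absurd h1 (by simp)

/-- Directions of the approximating tips converge to `(x, p)`, so the tips eventually share any
given initial stretch of `x`. Their relative heights are then some `y n`, close to `Z`, or at most
`1/(n+1)`, close to `0 ∈ Z`, or 1. The last occurs only over `(x, p')` with `p' ≠ p`, hence only if
`1 ∈ Z`. -/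
theorem mem_of_bladePoint_mem_closure {N : ℕ} {x : ℕ → Bool} (hx : ∀ n ≥ N, x n = false) (p : P)
    (hZ : IsClosed Z) (h0 : 0 ∈ Z)
    (hy : ∀ n, ∃ s ∈ Z, |L.y n - s| ≤ 1 / (n + 1))
    (hP : 1 ∉ Z → Subsingleton P) {s : unitInterval}
    (hs : L.bladePoint hj hi hx p s ∈ closure (endpoints (L.coneData hj hi).cone \
      (L.coneData hj hi).model.seg (L.bladePoint hj hi hx p 1))) : s ∈ Z := by
  by_cases hs0 : s = 0
  · exact hs0 ▸ h0
  have hne := L.bladePoint_ne_apex hj hi hx p hs0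
  obtain ⟨e, he, hlim⟩ := mem_closure_iff_seq_limit.1 hs
  have he1 := fun k => (L.mem_endpoints_cone_iff hj hi).1 (he k).1
  choose K z hz p' hzp using he1
  have hdir : Tendsto (fun k => (z k, p' k)) atTop (𝓝 (x, p)) := by
    have h := ((L.coneData hj hi).model.continuousOn_dir.continuousAt
      (isOpen_compl_singleton.mem_nhds hne)).tendsto.comp hlim
    rw [L.dir_bladePoint hj hi hx p hs0] at h
    refine h.congr fun k => ?_
    rw [Function.comp_apply, ← hzp k, L.dir_bladePoint hj hi (hz k) (p' k) one_ne_zero]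
  have hne' : ∀ k, (z k, p' k) ≠ (x, p) := by
    intro k h
    apply (he k).2
    rw [← hzp k]
    obtain ⟨h1, h2⟩ := Prod.mk.inj h
    have : L.bladePoint hj hi (hz k) (p' k) 1 = L.bladePoint hj hi hx p 1 := by
      refine congrArg (L.coneData hj hi).point (Subtype.ext (Prod.ext h ?_))
      have := L.param_one_unique (hz k) (M := N) (by rw [h1]; exact hx)
      rw [h1] at this
      simpa [h1] using this
    rw [this]
    exact RadialModel.self_mem_seg _ _
  have hu : Tendsto (fun k => (L.param N x).symm (L.param (K k) (z k) 1)) atTop (𝓝 (s : ℝ)) := by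
    have h := ((L.coneData hj hi).model.continuous_height.tendsto _).comp hlim
    rw [L.height_bladePoint] at h
    have h2 := ((L.param N x).symm.continuous.tendsto _).comp h
    rw [OrderIso.symm_apply_apply] at h2
    refine h2.congr fun k => ?_
    simp only [Function.comp_apply]
    rw [← hzp k, L.height_bladePoint]
    rfl
  let A : Set ℝ := Subtype.val '' Z
  have hA : IsClosed A := isClosed_Icc.isClosedEmbedding_subtypeVal.isClosedMap _ hZ
  have hAne : A.Nonempty := ⟨0, 0, h0, rfl⟩
  have hclose : ∀ M : ℕ, Metric.infDist (s : ℝ) A ≤ 1 / (M + 1) := by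
    intro M
    have hcont := ((Metric.continuous_infDist_pt A).tendsto (s : ℝ)).comp hu
    refine le_of_tendsto hcont ?_
    have hev : ∀ᶠ k in atTop, ∀ n < max N M, z k n = x n := by
      refine (eventually_all_finite (finite_lt_nat (max N M))).2 fun n _ => ?_
      have h : Tendsto (fun k => z k n) atTop (𝓝 (x n)) :=
        (((continuous_apply n).comp continuous_fst).tendsto (x, p)).comp hdir
      rwa [nhds_discrete, tendsto_pure] at h
    filter_upwards [hev] with k hk
    simp only [Function.comp_apply]
    by_cases hzx : z k = x
    · have h1 : (L.param N x).symm (L.param (K k) (z k) 1) = 1 := by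
        rw [OrderIso.symm_apply_eq, L.param_one_unique (hz k) (M := N) (by rw [hzx]; exact hx), hzx]
      have h1Z : (1 : unitInterval) ∈ Z := by
        by_contra h
        have := hP h
        exact hne' k (Prod.ext hzx (Subsingleton.elim _ _))
      rw [h1, Metric.infDist_zero_of_mem (show (1 : ℝ) ∈ A from ⟨1, h1Z, rfl⟩)]
      positivity
    · obtain ⟨n, hn, h⟩ := L.param_symm_near (le_max_left N M) hx (hz k) hk hzx
      have hnM : (1 : ℝ) / (n + 1) ≤ 1 / (M + 1) := by
        have : (M : ℝ) ≤ n := by exact_mod_cast (le_max_right N M).trans hn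
        gcongr
      refine le_trans ?_ hnM
      rcases h with h | h
      · obtain ⟨s', hs', hd⟩ := hy n
        rw [h]
        exact (Metric.infDist_le_dist_of_mem (mem_image_of_mem _ hs')).trans hd
      · refine (Metric.infDist_le_dist_of_mem (mem_image_of_mem _ h0)).trans ?_
        have hnn := L.param_symm_nonneg N x (L.param_one_pos (K k) (z k)).le
        rw [Icc.coe_zero, dist_zero_right, Real.norm_of_nonneg hnn]
        exact h.trans (L.bend_b_le n)
  have h0' : Metric.infDist (s : ℝ) A = 0 :=
    le_antisymm (ge_of_tendsto' tendsto_one_div_add_atTop_nhds_zero_nat hclose)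
      Metric.infDist_nonneg
  obtain ⟨s', hs', h⟩ := (hA.mem_iff_infDist_zero hAne).2 h0'
  exact (Subtype.ext h : s' = s) ▸ hs'

theorem isEPG_cone (hZ : IsClosed Z) (h0 : 0 ∈ Z)
    (hy1 : ∀ n, ∃ s ∈ Z, |L.y n - s| ≤ 1 / (n + 1))
    (hy2 : ∀ s ∈ Z, s ≠ 1 → ∀ K : ℕ, ∀ δ > 0, ∃ n ≥ K, |L.y n - s| < δ)
    (hP1 : 1 ∈ Z → ∀ p : P, (𝓝[≠] p).NeBot) (hP0 : 1 ∉ Z → Subsingleton P) :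
    IsEPG (L.coneData hj hi).apex Z := by
  rintro _ ⟨e, he, rfl⟩
  obtain ⟨N, x, hx, p, rfl⟩ := (L.mem_endpoints_cone_iff hj hi).1 he
  rw [(L.coneData hj hi).model.arcBetween_top]
  have hc : Continuous fun s => L.bladePoint hj hi hx p s :=
    (L.continuous_bladePoint hj hi hx).comp (by fun_prop : Continuous fun s => (p, s))
  have hinj : Function.Injective fun s => L.bladePoint hj hi hx p s := by
    intro s s' h
    have h' := congrArg (L.coneData hj hi).model.height h
    simp only [L.height_bladePoint] at h'
    exact Subtype.ext ((L.param N x).injective h')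
  have hrange : range (fun s => L.bladePoint hj hi hx p s) =
      (L.coneData hj hi).model.seg (L.bladePoint hj hi hx p 1) := by
    ext z
    rw [mem_seg_bladePoint_one_iff]
    rfl
  refine ⟨(hc.isClosedEmbedding hinj).isEmbedding.toHomeomorph.trans (Homeomorph.setCongr hrange),
    L.bladePoint_zero hj hi hx p, ?_⟩
  ext z
  constructor
  · rintro ⟨s, hs, rfl⟩
    exact ⟨Subtype.coe_prop _, L.bladePoint_mem_closure hj hi hx p hy2 hP1 hs⟩
  · rintro ⟨hz1, hz2⟩
    obtain ⟨s, rfl⟩ := (L.mem_seg_bladePoint_one_iff hj hi hx p).1 hz1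
    exact ⟨s, L.mem_of_bladePoint_mem_closure hj hi hx p hZ h0 hy1 hP0 hz2, rfl⟩

theorem isEndpointHomogeneousSmoothEPGFan_cone (hP : ∀ p p' : P, ∃ τ : P ≃ₜ P, τ p = p')
    (hZ : IsClosed Z) (h0 : 0 ∈ Z)
    (hy1 : ∀ n, ∃ s ∈ Z, |L.y n - s| ≤ 1 / (n + 1))
    (hy2 : ∀ s ∈ Z, s ≠ 1 → ∀ K : ℕ, ∀ δ > 0, ∃ n ≥ K, |L.y n - s| < δ)
    (hP1 : 1 ∈ Z → ∀ p : P, (𝓝[≠] p).NeBot) (hP0 : 1 ∉ Z → Subsingleton P) :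
    IsEndpointHomogeneousSmoothEPGFan (L.coneData hj hi).cone (L.coneData hj hi).apex Z where
  fan := (L.coneData hj hi).model.isFanWithTop (L.exists_three_directions hj hi)
  smooth := (L.coneData hj hi).model.isSmoothAt
  endpointHomogeneous := L.endpointHomogeneous_cone hj hi hP
  epg := L.isEPG_cone hj hi hZ h0 hy1 hy2 hP1 hP0

end EPG

end BladeLengths

end Fans

/-! ### Choice of the lengths, the Cantor factor and the collapsed product -/

namespace Fans

theorem exists_homeomorph_cantorSet (k k' : cantorSet) : ∃ τ : cantorSet ≃ₜ cantorSet, τ k = k' := by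
  let h := cantorSetHomeomorphNatToBool
  refine ⟨(h.trans (xorHomeomorph fun n => xor (h k n) (h k' n))).trans h.symm, ?_⟩
  rw [Homeomorph.trans_apply, Homeomorph.trans_apply, xorHomeomorph_self, h.symm_apply_apply]

theorem nhdsNE_cantorSet_neBot (k : cantorSet) : (𝓝[≠] k).NeBot := by
  let h := cantorSetHomeomorphNatToBool
  have hlim : Tendsto (fun n => h.symm (Function.update (h k) n (!(h k n)))) atTop (𝓝 k) := by
    have := (h.symm.continuous.tendsto (h k)).comp
      (tendsto_update_nhds (h k) tendsto_id fun n => !(h k n))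
    rwa [h.symm_apply_apply] at this
  suffices ∀ n, h.symm (Function.update (h k) n (!(h k n))) ≠ k from
    (tendsto_nhdsWithin_of_tendsto_nhds_of_eventually_within _ hlim
      (Eventually.of_forall this)).neBot
  intro n hn
  have h1 : Function.update (h k) n (!(h k n)) = h k := by
    rw [← h.apply_symm_apply (Function.update (h k) n _)]
    exact congrArg h hn
  have h2 := congrFun h1 n
  simp at h2

instance : CompactSpace cantorSet := isCompact_iff_compactSpace.1 isCompact_cantorSet

instance : TotallyDisconnectedSpace cantorSet :=
  ⟨cantorSetHomeomorphNatToBool.isEmbedding.isTotallyDisconnected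
    (isTotallyDisconnected_of_totallyDisconnectedSpace _)⟩

instance : Nonempty cantorSet := ⟨⟨0, zero_mem_cantorSet⟩⟩

namespace BladeLengths

/-- A closed set of relative heights bounded away from `1` is the set of limit points of the
lengths in some sequence. -/
theorem exists_lengths {Y : Set unitInterval} (hne : Y.Nonempty) {b : ℝ} (hb0 : 0 < b)
    (hb1 : b < 1) (hb : ∀ s ∈ Y, (s : ℝ) ≤ b) : ∃ L : BladeLengths,
      (∀ n, ∃ s ∈ Y, |L.y n - s| ≤ 1 / (n + 1)) ∧
      ∀ s ∈ Y, ∀ K : ℕ, ∀ δ > 0, ∃ n ≥ K, |L.y n - s| < δ := by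
  have : Nonempty Y := hne.to_subtype
  obtain ⟨d, hd⟩ := TopologicalSpace.exists_dense_seq Y
  have hdiv : ∀ n : ℕ, 0 < b / (n + 1) := fun n => by positivity
  have hdist : ∀ (n : ℕ) (r : ℝ), 0 ≤ r → |max r (b / (n + 1)) - r| ≤ 1 / (n + 1) := by
    intro n r hr
    rw [abs_of_nonneg (sub_nonneg.2 (le_max_left _ _)), sub_le_iff_le_add]
    have h1 : b / (n + 1) ≤ 1 / ((n : ℝ) + 1) := by gcongr
    have h2 : (0 : ℝ) ≤ 1 / ((n : ℝ) + 1) := by positivity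
    exact max_le (by linarith) (by linarith)
  -- Unpairing makes every term of the dense sequence recur infinitely often; the maximum with `b /
  -- (n + 1)` keeps lengths positive even where the term is 0.
  refine ⟨⟨b, fun n => max (d n.unpair.1) (b / (n + 1)), hb0, hb1,
    fun n => lt_max_of_lt_right (hdiv n), fun n => max_le (hb _ (d _).2)
      (div_le_self hb0.le (by simp))⟩, fun n => ⟨d n.unpair.1, (d _).2, hdist n _ (d _).1.2.1⟩, ?_⟩
  intro s hs K δ hδ
  obtain ⟨i, hi⟩ := hd.exists_dist_lt ⟨s, hs⟩ (half_pos hδ)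
  obtain ⟨m, hm⟩ := exists_nat_one_div_lt (half_pos hδ)
  have hn : max K m ≤ Nat.pair i (max K m) := Nat.right_le_pair _ _
  refine ⟨Nat.pair i (max K m), (le_max_left _ _).trans hn, ?_⟩
  have h1 := hdist (Nat.pair i (max K m)) (d i) (d i).1.2.1
  have h2 : (1 : ℝ) / ((Nat.pair i (max K m) : ℕ) + 1) ≤ 1 / (m + 1) := by
    have : (m : ℝ) ≤ (Nat.pair i (max K m) : ℕ) := by exact_mod_cast (le_max_right K m).trans hn
    gcongr
  have h3 : |((d i : unitInterval) : ℝ) - s| < δ / 2 := by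
    rw [abs_sub_comm]; exact hi
  simp only [Nat.unpair_pair]
  calc _ ≤ _ := abs_sub_le _ ((d i : unitInterval) : ℝ) _
    _ < δ := by linarith

/-- The map `((r, (a, c)), k) ↦ (r, (a, r * k))` forgets `k` exactly at the apex. Being a continuous
surjection from a compact space to a Hausdorff one, it is a quotient map, and its fibres are the
classes of the collapse. The regions agree because ray lengths depend only on the sequence. -/
theorem nonempty_homeomorph_collapsedProduct (L : BladeLengths)
    (hi : Function.Injective fun _ : PUnit.{1} => (0 : ℝ)) :
    Nonempty ((L.coneData continuous_subtype_val
      (Subtype.val_injective : Function.Injective ((↑) : cantorSet → ℝ))).cone ≃ₜ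
        CollapsedProduct (L.coneData continuous_const hi).apex) := by
  set C₁ := L.coneData continuous_const hi
  set C₂ := L.coneData continuous_subtype_val
      (Subtype.val_injective : Function.Injective ((↑) : cantorSet → ℝ))
  have hmem : ∀ (z : C₁.cone) (k : cantorSet),
      ((z.1.1, (z.1.2.1, z.1.1 * k)) : ℝ × (ℝ × ℝ)) ∈ C₂.cone := by
    rintro ⟨_, ⟨⟨x, u⟩, r⟩, hq, rfl⟩ k
    exact ⟨((x, k), r), hq, rfl⟩
  let f : C₁.cone × cantorSet → C₂.cone := fun q => ⟨_, hmem q.1 q.2⟩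
  have hf : Continuous f := by
    apply Continuous.subtype_mk
    fun_prop
  have hpt : ∀ (x : ℕ → Bool) (u : PUnit) (r : ℝ) (h : ((x, u), r) ∈ C₁.region) (k : cantorSet),
      f (C₁.point ⟨((x, u), r), h⟩, k) = C₂.point ⟨((x, k), r), h⟩ := fun _ _ _ _ _ => rfl
  have hsurj : Function.Surjective f := by
    intro z
    obtain ⟨⟨⟨⟨x, k⟩, r⟩, h⟩, rfl⟩ := C₂.point_surjective z
    exact ⟨(C₁.point ⟨((x, PUnit.unit), r), h⟩, k), rfl⟩
  have hker : collapseSetoid C₁.apex = Setoid.ker f := by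
    ext ⟨z, k⟩ ⟨z', k'⟩
    obtain ⟨⟨⟨⟨x, u⟩, r⟩, h⟩, rfl⟩ := C₁.point_surjective z
    obtain ⟨⟨⟨⟨x', u'⟩, r'⟩, h'⟩, rfl⟩ := C₁.point_surjective z'
    rw [Setoid.ker_def, hpt, hpt, C₂.point_eq_point_iff]
    change ((C₁.point ⟨((x, u), r), h⟩, k) = (C₁.point ⟨((x', u'), r'), h'⟩, k') ∨
      (C₁.point ⟨((x, u), r), h⟩ = C₁.apex ∧ C₁.point ⟨((x', u'), r'), h'⟩ = C₁.apex)) ↔ _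
    rw [C₁.point_eq_apex_iff, C₁.point_eq_apex_iff, Prod.mk.injEq, C₁.point_eq_point_iff]
    simp only [Subtype.ext_iff, Prod.mk.injEq]
    tauto
  have hq : IsQuotientMap f := IsQuotientMap.of_surjective_continuous hsurj hf
  unfold CollapsedProduct
  rw [hker]
  exact ⟨(IsQuotientMap.homeomorph (f := ⟨f, hf⟩) hq).symm⟩

end BladeLengths

end Fans

theorem mainTheorem5 (X : Set unitInterval) (hX : IsClosed X)
    (h0 : (0 : unitInterval) ∈ X) (h1 : (1 : unitInterval) ∈ X)
    (hiso : ∃ U : Set unitInterval, IsOpen U ∧ U ∩ X = {1}) :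
    ∃ (FY : Type) (_ : MetricSpace FY) (t₀ : FY) (F : Type) (_ : MetricSpace F) (t : F),
      Fans.IsEndpointHomogeneousSmoothEPGFan FY t₀ (X \ {1}) ∧
      Nonempty (F ≃ₜ Fans.CollapsedProduct t₀) ∧
      Fans.IsEndpointHomogeneousSmoothEPGFan F t X := by
  obtain ⟨U, hU, hUX⟩ := hiso
  have hY : IsClosed (X \ {1}) := by
    have : X \ {1} = X \ U := by
      rw [← hUX, inter_comm, sdiff_self_inter]
    rw [this]
    exact hX.sdiff hU
  have hY0 : (0 : unitInterval) ∈ X \ {1} := ⟨h0, zero_ne_one⟩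
  have h1U : (1 : unitInterval) ∈ U := (hUX.symm ▸ mem_singleton _ : (1 : unitInterval) ∈ U ∩ X).1
  obtain ⟨ε, hε, hball⟩ := Metric.isOpen_iff.1 hU 1 h1U
  -- The entry `1 / 2` keeps the bound positive when `ε ≥ 1`.
  have hb : ∀ s ∈ X \ {1}, (s : ℝ) ≤ max (1 / 2) (1 - ε) := by
    intro s hs
    by_contra! hlt
    have hsU : s ∈ U := hball (by
      rw [Metric.mem_ball, Subtype.dist_eq, Real.dist_eq, Icc.coe_one, abs_sub_comm,
        abs_of_nonneg (sub_nonneg.2 s.2.2)]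
      linarith [(le_max_right _ _).trans_lt hlt])
    exact hs.2 (hUX ▸ ⟨hsU, hs.1⟩ : s ∈ ({1} : Set unitInterval))
  obtain ⟨L, hL1, hL2⟩ := Fans.BladeLengths.exists_lengths ⟨0, hY0⟩
    (lt_max_of_lt_left (by norm_num)) (max_lt (by norm_num) (by linarith)) hb
  have hi : Function.Injective fun _ : PUnit.{1} => (0 : ℝ) := fun _ _ _ => rfl
  refine ⟨(L.coneData continuous_const hi).cone, inferInstance,
    (L.coneData continuous_const hi).apex,
    (L.coneData continuous_subtype_val
      (Subtype.val_injective : Function.Injective ((↑) : cantorSet → ℝ))).cone, inferInstance,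
    (L.coneData continuous_subtype_val Subtype.val_injective).apex, ?_,
    L.nonempty_homeomorph_collapsedProduct hi, ?_⟩
  -- The same lengths serve both fans; only `P` changes, from a point to the Cantor set, whose lack
  -- of isolated points supplies the value 1.
  · exact L.isEndpointHomogeneousSmoothEPGFan_cone _ _
      (fun _ _ => ⟨Homeomorph.refl _, rfl⟩) hY hY0 hL1 (fun s hs _ => hL2 s hs)
      (fun h => absurd rfl h.2) fun _ => inferInstance
  · exact L.isEndpointHomogeneousSmoothEPGFan_cone _ _ Fans.exists_homeomorph_cantorSet hX h0
      (fun n => (hL1 n).imp fun _ h => ⟨h.1.1, h.2⟩) (fun s hs hs1 => hL2 s ⟨hs, hs1⟩)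
      (fun _ => Fans.nhdsNE_cantorSet_neBot) fun h => absurd h1 h
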